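/- **Setting.** Let $\alpha=(\alpha_1,\dots,\alpha_n)\neq 0$ be nonnegative integers, $I_\alpha=\{i : \alpha_i>0\}$, and let $k\ge 1$ be an integer. Let $\tilde U$ be an open set of values of the coordinates $(x_j)_{j\notin I_\alpha}$ and $U=\{x\in\mathbb R^n : (x_j)_{j\notin I_\alpha}\in\tilde U\}$. Let $f:U\to\mathbb R^n$ be a smooth vector field that is asymptotically quasi-homogeneous of type $\alpha$ and order $k+1$ at infinity: there is a smooth $f_{\alpha,k}:U\to\mathbb R^n$ with $(f_{\alpha,k})_j(R^{\alpha_1}x_1,\dots,R^{\alpha_n}x_n)=R^{k+\alpha_j}(f_{\alpha,k})_j(x)$ for all $x\in U$, $R\in\mathbb R$ and all $j$, such that, for each $j$, $$\lim_{R\to+\infty}R^{-(k+\alpha_j)}\bigl\{f_j(R^{\alpha_1}x_1,\dots,R^{\alpha_n}x_n)-R^{k+\alpha_j}(f_{\alpha,k})_j(x)\bigr\}=0$$ uniformly on $\{x\in U:\sum_{i\in I_\alpha}x_i^2=1\}$. Let $a_1,\dots,a_n\ge 1$ be reals, $c\ge1$ an integer, and $\beta_1,\dots,\beta_n$ nonnegative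 integers with $\alpha_i\beta_i=c$ for $i\in I_\alpha$ and $\beta_i=0$ otherwise. Put $$p(y)=\Bigl(\sum_{i\in I_\alpha}a_iy_i^{2\beta_i}\Bigr)^{1/2c},\qquad \kappa(y)=(1+p(y)^{2c})^{1/2c},\qquad T_{qP}(y)_i=y_i/\kappa(y)^{\alpha_i},$$ $\mathcal D=\{x=T_{qP}(y) : y\in U,\ p(x)<1\}$, $\mathcal E=\{x\in U : p(x)=1\}$ (the horizon) and $\overline{\mathcal D}=\mathcal D\cup\mathcal E$. For $x\in\mathcal D$ let $\kappa=(1-\sum_{j\in I_\alpha}a_jx_j^{2\beta_j})^{-1/2c}$ and $\tilde f_j(x)=\kappa^{-(k+\alpha_j)}f_j(\kappa^{\alpha_1}x_1,\dots,\kappa^{\alpha_n}x_n)$; for $x\in\mathcal E$ let $\tilde f(x)=f_{\alpha,k}(x)$. The desingularized vector field $g$ on $\overline{\mathcal D}$ is $$g_i=\tilde f_i-\Bigl(\sum_{j\in I_\alpha}\beta_ja_jx_j^{2\beta_j-1}\tilde f_j\Bigr)\frac{x_i}{\beta_i}\quad(i\in I_\alpha),\qquad g_i=\tilde f_i\quad(i\notin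 I_\alpha).$$ **Theorem (Stationary blow-up).** Let $x_*\in\mathcal E$ be an equilibrium at infinity, i.e. $g(x_*)=0$. Suppose that $g$ is $C^1$ on a set $V\supset\mathcal E$ that is open in $\overline{\mathcal D}$, and that $x_*$ is hyperbolic: no eigenvalue of the Jacobian matrix $Jg(x_*)$ has real part zero, and the number $n_s$ of those with negative real part is positive. Let $W^s(x_*)$ be the set of initial points $x(0)$ of solutions $x(\tau)\in\overline{\mathcal D}$, $\tau\ge0$, of $dx/d\tau=g(x)$ with $x(\tau)\to x_*$ as $\tau\to\infty$. Let $y(t)$, $t_0\le t<t_{\max}\le\infty$, be a solution of $y'=f(y)$ in $U$ with maximal existence time $t_{\max}$, whose image under $T_{qP}$ lies on $W^s(x_*)$ (it suffices that $T_{qP}(y(t_0))\in W^s(x_*)$). Then $t_{\max}<\infty$, and there is a constant $C>0$ with $$\frac{p(y(t))}{C\,(t_{\max}-t)^{-1/k}}\to 1\qquad\text{as } t\to t_{\max}-0 .$$ Moreover, for every $i\in I_\alpha$ with $(x_*)_i\ne0$ there is a constant $C_i\neq0$ with $$\frac{y_i(t)}{C_i\,(t_{\max}-t)^{-\alpha_i/k}}\to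 1\qquad\text{as } t\to t_{\max}-0 .$$ -/

import Mathlib

open Set Filter Topology Asymptotics
open scoped ContDiff

noncomputable section

namespace QuasiPoincare

variable {n : ℕ}

/-- The set `I_α` of homogeneity indices. -/
def homIndices (α : Fin n → ℕ) : Finset (Fin n) :=
  Finset.univ.filter fun i => 0 < α i

/-- The quasi-homogeneous scaling `x ↦ (R^{α_1} x_1, …, R^{α_n} x_n)`. -/
def scale (α : Fin n → ℕ) (R : ℝ) (x : Fin n → ℝ) : Fin n → ℝ :=
  fun i => R ^ α i * x i

/-- The admissible domain over a set `W` (open, in all uses) of values of the coordinates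
outside `I_α`; the coordinates in `I_α` are unrestricted. -/
def admissibleDomain (α : Fin n → ℕ) (W : Set ({i : Fin n // α i = 0} → ℝ)) :
    Set (Fin n → ℝ) :=
  {x | (fun j : {i : Fin n // α i = 0} => x j) ∈ W}

/-- The part of the admissible domain whose `I_α`-coordinates lie on the Euclidean unit sphere. -/
def sphereDomain (α : Fin n → ℕ) (W : Set ({i : Fin n // α i = 0} → ℝ)) :
    Set (Fin n → ℝ) :=
  {x | x ∈ admissibleDomain α W ∧ ∑ i ∈ homIndices α, x i ^ 2 = 1}

/-- `F` is a smooth quasi-homogeneous vector field of type `α` and order `k + 1` on `U`. -/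
structure IsQuasiHomogeneous (α : Fin n → ℕ) (k : ℕ) (U : Set (Fin n → ℝ))
    (F : (Fin n → ℝ) → (Fin n → ℝ)) : Prop where
  smooth : ContDiffOn ℝ ∞ F U
  homogeneous : ∀ x ∈ U, ∀ (R : ℝ) (j : Fin n), F (scale α R x) j = R ^ (k + α j) * F x j

/-- `f` is a smooth vector field on the admissible domain over `W`, asymptotically
quasi-homogeneous of type `α` and order `k + 1` at infinity, with quasi-homogeneous
part `fα`. -/
structure IsAsymptoticallyQuasiHomogeneous (α : Fin n → ℕ) (k : ℕ)
    (W : Set ({i : Fin n // α i = 0} → ℝ)) (f fα : (Fin n → ℝ) → (Fin n → ℝ)) : Prop where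
  smooth : ContDiffOn ℝ ∞ f (admissibleDomain α W)
  quasiHomogeneous : IsQuasiHomogeneous α k (admissibleDomain α W) fα
  tendsto : ∀ j : Fin n, TendstoUniformlyOn
    (fun (R : ℝ) x => (R ^ (k + α j))⁻¹ * (f (scale α R x) j - R ^ (k + α j) * fα x j))
    (fun _ => 0) atTop (sphereDomain α W)

/-- Admissible parameters of a quasi-Poincaré compactification of type `α`. -/
structure IsCompactificationData (α β : Fin n → ℕ) (c : ℕ) (a : Fin n → ℝ) : Prop where
  type_ne_zero : α ≠ 0
  c_pos : 0 < c
  one_le_a : ∀ i, 1 ≤ a i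
  mul_eq : ∀ i ∈ homIndices α, α i * β i = c
  eq_zero : ∀ i ∉ homIndices α, β i = 0

variable (α β : Fin n → ℕ) (c : ℕ) (a : Fin n → ℝ)

/-- The functional `p`. -/
def p (y : Fin n → ℝ) : ℝ :=
  (∑ i ∈ homIndices α, a i * y i ^ (2 * β i)) ^ (1 / (2 * c : ℝ))

/-- The functional `κ`. -/
def kappa (y : Fin n → ℝ) : ℝ :=
  (1 + p α β c a y ^ (2 * c)) ^ (1 / (2 * c : ℝ))

/-- The quasi-Poincaré compactification `T_{qP}`. -/
def compactification (y : Fin n → ℝ) : Fin n → ℝ :=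
  fun i => y i / kappa α β c a y ^ α i

/-- The horizon `ℰ = {x ∈ U | p(x) = 1}`. -/
def horizon (W : Set ({i : Fin n // α i = 0} → ℝ)) : Set (Fin n → ℝ) :=
  {x | x ∈ admissibleDomain α W ∧ p α β c a x = 1}

/-- The set `𝒟 = {x | x = T_{qP}(y), y ∈ U, p(x) < 1}`. -/
def disc (W : Set ({i : Fin n // α i = 0} → ℝ)) : Set (Fin n → ℝ) :=
  {x | x ∈ compactification α β c a '' admissibleDomain α W ∧ p α β c a x < 1}

/-- The compactified phase space: `𝒟` together with the horizon
(the closure of `𝒟` relative to `U`). -/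
def closedDisc (W : Set ({i : Fin n // α i = 0} → ℝ)) : Set (Fin n → ℝ) :=
  disc α β c a W ∪ horizon α β c a W

/-- The functional `κ` in the `x`-coordinate, `κ(T_{qP}⁻¹(x))`, for `p(x) < 1`. -/
def kappaX (x : Fin n → ℝ) : ℝ :=
  (1 - ∑ j ∈ homIndices α, a j * x j ^ (2 * β j)) ^ (-(1 / (2 * c : ℝ)))

/-- The rescaled field `f̃_j(x) = κ^{-(k+α_j)} f_j(κ^{α_1} x_1, …, κ^{α_n} x_n)`, extended to the
horizon by its limit, the quasi-homogeneous part `fα`. -/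
def fTilde (k : ℕ) (f fα : (Fin n → ℝ) → (Fin n → ℝ)) (x : Fin n → ℝ) : Fin n → ℝ :=
  fun j =>
    if p α β c a x < 1 then
      (kappaX α β c a x ^ (k + α j))⁻¹ * f (scale α (kappaX α β c a x) x) j
    else fα x j

/-- The desingularized vector field `g`. -/
def desingularized (k : ℕ) (f fα : (Fin n → ℝ) → (Fin n → ℝ)) (x : Fin n → ℝ) : Fin n → ℝ :=
  fun i =>
    if i ∈ homIndices α then
      fTilde α β c a k f fα x i -
        (∑ j ∈ homIndices α, β j * a j * x j ^ (2 * β j - 1) * fTilde α β c a k f fα x j) *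
          (x i / β i)
    else fTilde α β c a k f fα x i

/-- `x` is an equilibrium at infinity: a zero of `g` on the horizon. -/
def IsEquilibriumAtInfinity (W : Set ({i : Fin n // α i = 0} → ℝ)) (k : ℕ)
    (f fα : (Fin n → ℝ) → (Fin n → ℝ)) (x : Fin n → ℝ) : Prop :=
  x ∈ horizon α β c a W ∧ desingularized α β c a k f fα x = 0

/-- The Jacobian matrix of `g` at `x`, the derivative being taken within the set `s`. -/
def jacobianWithin (g : (Fin n → ℝ) → (Fin n → ℝ)) (s : Set (Fin n → ℝ)) (x : Fin n → ℝ) :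
    Matrix (Fin n) (Fin n) ℝ :=
  LinearMap.toMatrix' (fderivWithin ℝ g s x : (Fin n → ℝ) →ₗ[ℝ] (Fin n → ℝ))

/-- The complex eigenvalues of a real matrix, with algebraic multiplicity. -/
def eigenvaluesC (J : Matrix (Fin n) (Fin n) ℝ) : Multiset ℂ :=
  (J.map (algebraMap ℝ ℂ)).charpoly.roots

/-- No eigenvalue lies on the imaginary axis. -/
def IsHyperbolicMatrix (J : Matrix (Fin n) (Fin n) ℝ) : Prop :=
  ∀ μ ∈ eigenvaluesC J, μ.re ≠ 0

/-- The number `n_s` of eigenvalues with negative real part. -/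
def stableCount (J : Matrix (Fin n) (Fin n) ℝ) : ℕ :=
  ((eigenvaluesC J).filter fun μ => μ.re < 0).card

/-- The stable set `W^s(x_*)` of `x_*` for `g` in the phase space `s`: all initial points of
solutions of `dx/dτ = g(x)` in `s` that exist for all `τ ≥ 0` and converge to `x_*`. -/
def stableSet (g : (Fin n → ℝ) → (Fin n → ℝ)) (s : Set (Fin n → ℝ)) (xs : Fin n → ℝ) :
    Set (Fin n → ℝ) :=
  {x₀ | ∃ x : ℝ → (Fin n → ℝ), x 0 = x₀ ∧
    (∀ τ, 0 ≤ τ → x τ ∈ s ∧ HasDerivWithinAt x (g (x τ)) (Ici 0) τ) ∧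
    Tendsto x atTop (𝓝 xs)}

/-- `y` solves `y' = f(y)` in `U` on `[t₀, T)`. -/
def IsSolutionOn (f : (Fin n → ℝ) → (Fin n → ℝ)) (U : Set (Fin n → ℝ))
    (y : ℝ → (Fin n → ℝ)) (t₀ : ℝ) (T : EReal) : Prop :=
  ∀ t : ℝ, t₀ ≤ t → (t : EReal) < T →
    y t ∈ U ∧ HasDerivWithinAt y (f (y t)) (Ici t₀) t

/-- `y` solves `y' = f(y)` in `U` on `[t₀, T)`, and `T` is its maximal existence time: no
solution on a longer interval `[t₀, T')` extends `y`. -/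
structure IsMaximalSolution (f : (Fin n → ℝ) → (Fin n → ℝ)) (U : Set (Fin n → ℝ))
    (y : ℝ → (Fin n → ℝ)) (t₀ : ℝ) (T : EReal) : Prop where
  lt : (t₀ : EReal) < T
  solution : IsSolutionOn f U y t₀ T
  maximal : ∀ (T' : EReal) (z : ℝ → (Fin n → ℝ)), IsSolutionOn f U z t₀ T' →
    (∀ t : ℝ, t₀ ≤ t → (t : EReal) < T → z t = y t) → T' ≤ T

end QuasiPoincare

end

/-! Write `q = p^{2c}` (`gauge`), `x = T_{qP}(y)`, and let `G = ∑ β_j a_j x_j^{2β_j-1} f̃_j` be the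
radial rate (`radialRate`). Everything is governed by the scalar `G`, evaluated at `x_*`.

Since `α_i β_i = c`, the chain rule gives `x' = κ^k g(x)`, so that `x` follows an orbit of `g` in
the time `dτ = κ^k dt`, and `(κ^{-k})' = -(k/c) G(x)`. Along `g` itself, Euler's identity for `q`
gives `Dq(x) g(x) = 2 G(x) (1 - q(x))` (`fderiv_gauge_desingularized`).

Differentiating the last identity at `x_*`, where `g = 0` and `q = 1`, yields `Dq ∘ Jg = -2 G(x_*)
Dq`. Thus `Dq(x_*)`, which is nonzero by Euler, is a left eigenvector of eigenvalue `-2 G(x_*)`, and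
hyperbolicity forces `G(x_*) ≠ 0` (`radialRate_ne_zero`). Along the given orbit `1 - q` stays
positive and tends to `0` while solving `w' = -2 G w`, which excludes `G(x_*) < 0`
(`radialRate_nonneg_of_tendsto`). Hence `G(x_*) > 0`; no stable manifold theorem is needed.

By uniqueness for `g` inside `𝒟`, `x(t)` is this orbit at time `τ(t)`, and `τ → ∞` as `t → t_max`,
so `x(t) → x_*`. Therefore `κ^{-k}` is positive with slope tending to `-(k/c) G(x_*) < 0`: it cannot
live forever, so `t_max < ∞`, and l'Hôpital's rule gives `κ^{-k} ~ (k/c) G(x_*) (t_max - t)`. The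
rates follow from `p(y) = κ p(x)` and `y_i = κ^{α_i} x_i`. The limit of `G` requires `f̃` to be
continuous up to the horizon, which is where the asymptotic hypothesis enters. -/

namespace QuasiPoincare

/-! ### The compactification, its inverse, and the quasi-homogeneous polynomial `q` -/

section Algebra

variable {n : ℕ} {α β : Fin n → ℕ} {c : ℕ} {a : Fin n → ℝ}

/-- The polynomial `∑ a_i x_i ^ (2 β_i)`, so that `p ^ (2 c)` is `gauge`. -/
noncomputable def gauge (α β : Fin n → ℕ) (a : Fin n → ℝ) (x : Fin n → ℝ) : ℝ :=
  ∑ i ∈ homIndices α, a i * x i ^ (2 * β i)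

theorem mem_homIndices {i : Fin n} : i ∈ homIndices α ↔ 0 < α i := by
  simp [homIndices]

theorem scale_mem_admissibleDomain {W : Set ({i : Fin n // α i = 0} → ℝ)} (R : ℝ)
    {x : Fin n → ℝ} : scale α R x ∈ admissibleDomain α W ↔ x ∈ admissibleDomain α W := by
  have : (fun j : {i : Fin n // α i = 0} => scale α R x j) =
      fun j : {i : Fin n // α i = 0} => x j := by
    ext j
    simp [scale, j.2]
  simp only [admissibleDomain, mem_ofPred_eq, this]

theorem kappaX_pos {x : Fin n → ℝ} (hx : gauge α β a x < 1) : 0 < kappaX α β c a x :=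
  Real.rpow_pos_of_pos (by rw [gauge] at hx; linarith) _

namespace IsCompactificationData

theorem beta_pos (h : IsCompactificationData α β c a) {i : Fin n} (hi : i ∈ homIndices α) :
    0 < β i := by
  have h1 := h.mul_eq i hi
  have h2 := h.c_pos
  rcases Nat.eq_zero_or_pos (β i) with h3 | h3
  · rw [h3] at h1; omega
  · exact h3

theorem two_c_ne_zero (h : IsCompactificationData α β c a) : 2 * c ≠ 0 := by have := h.c_pos; omega

theorem two_c_pos (h : IsCompactificationData α β c a) :
    (0 : ℝ) < 2 * c := by have := h.c_pos; positivity

theorem gauge_nonneg (h : IsCompactificationData α β c a) (x : Fin n → ℝ) : 0 ≤ gauge α β a x := by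
  refine Finset.sum_nonneg fun i _ => mul_nonneg (by linarith [h.one_le_a i]) ?_
  exact (even_two_mul _).pow_nonneg _

theorem rpow_pow_two_c (h : IsCompactificationData α β c a) {x : ℝ} (hx : 0 ≤ x) :
    (x ^ (1 / (2 * c : ℝ))) ^ (2 * c) = x := by
  have := Real.rpow_inv_natCast_pow hx h.two_c_ne_zero
  push_cast at this
  rwa [one_div]

theorem pow_two_c_rpow (h : IsCompactificationData α β c a) {x : ℝ} (hx : 0 ≤ x) :
    (x ^ (2 * c)) ^ (1 / (2 * c : ℝ)) = x := by
  have := Real.pow_rpow_inv_natCast hx h.two_c_ne_zero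
  push_cast at this
  rwa [one_div]

theorem p_nonneg (h : IsCompactificationData α β c a) (x : Fin n → ℝ) : 0 ≤ p α β c a x :=
  Real.rpow_nonneg (h.gauge_nonneg x) _

theorem p_pow (h : IsCompactificationData α β c a) (x : Fin n → ℝ) :
    p α β c a x ^ (2 * c) = gauge α β a x :=
  h.rpow_pow_two_c (h.gauge_nonneg x)

theorem p_lt_one_iff (h : IsCompactificationData α β c a) (x : Fin n → ℝ) :
    p α β c a x < 1 ↔ gauge α β a x < 1 := by
  rw [← h.p_pow x, pow_lt_one_iff_of_nonneg (h.p_nonneg x) h.two_c_ne_zero]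

theorem p_eq_one_iff (h : IsCompactificationData α β c a) (x : Fin n → ℝ) :
    p α β c a x = 1 ↔ gauge α β a x = 1 := by
  rw [← h.p_pow x, pow_eq_one_iff_of_nonneg (h.p_nonneg x) h.two_c_ne_zero]

theorem kappa_eq (h : IsCompactificationData α β c a) (y : Fin n → ℝ) :
    kappa α β c a y = (1 + gauge α β a y) ^ (1 / (2 * c : ℝ)) := by
  rw [kappa, h.p_pow]

theorem kappa_pos (h : IsCompactificationData α β c a) (y : Fin n → ℝ) : 0 < kappa α β c a y := by
  rw [h.kappa_eq]
  exact Real.rpow_pos_of_pos (by linarith [h.gauge_nonneg y]) _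

theorem kappa_pow (h : IsCompactificationData α β c a) (y : Fin n → ℝ) :
    kappa α β c a y ^ (2 * c) = 1 + gauge α β a y := by
  rw [h.kappa_eq, h.rpow_pow_two_c (by linarith [h.gauge_nonneg y])]

theorem one_le_kappa (h : IsCompactificationData α β c a) (y : Fin n → ℝ) :
    1 ≤ kappa α β c a y := by
  rw [h.kappa_eq]
  have := h.two_c_pos
  exact Real.one_le_rpow (by linarith [h.gauge_nonneg y]) (by positivity)

theorem kappaX_pow (h : IsCompactificationData α β c a) {x : Fin n → ℝ} (hx : gauge α β a x < 1) :
    kappaX α β c a x ^ (2 * c) = (1 - gauge α β a x)⁻¹ := by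
  have h1 : 0 ≤ 1 - gauge α β a x := by linarith
  change ((1 - gauge α β a x) ^ (-(1 / (2 * c : ℝ)))) ^ (2 * c) = _
  rw [Real.rpow_neg h1, inv_pow, h.rpow_pow_two_c h1]

theorem gauge_scale (h : IsCompactificationData α β c a) (R : ℝ) (x : Fin n → ℝ) :
    gauge α β a (scale α R x) = R ^ (2 * c) * gauge α β a x := by
  simp only [gauge, scale, Finset.mul_sum]
  refine Finset.sum_congr rfl fun i hi => ?_
  rw [← h.mul_eq i hi]
  ring

theorem p_scale (h : IsCompactificationData α β c a) {R : ℝ} (hR : 0 ≤ R) (x : Fin n → ℝ) :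
    p α β c a (scale α R x) = R * p α β c a x := by
  change gauge α β a (scale α R x) ^ (1 / (2 * c : ℝ)) = R * gauge α β a x ^ (1 / (2 * c : ℝ))
  rw [h.gauge_scale, Real.mul_rpow (by positivity) (h.gauge_nonneg x), h.pow_two_c_rpow hR]

theorem scale_kappa (h : IsCompactificationData α β c a) (y : Fin n → ℝ) :
    scale α (kappa α β c a y) (compactification α β c a y) = y := by
  ext i
  have := (h.kappa_pos y).ne'
  simp only [scale, compactification]
  field_simp

/-- Homogeneity at `R = κ` gives `κ^{2c} = 1 + q(y) = 1 + κ^{2c} q(x)`; divide by `κ^{2c}`. -/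
theorem gauge_compactification (h : IsCompactificationData α β c a) (y : Fin n → ℝ) :
    1 - gauge α β a (compactification α β c a y) = (kappa α β c a y ^ (2 * c))⁻¹ := by
  have h1 := h.gauge_scale (kappa α β c a y) (compactification α β c a y)
  rw [h.scale_kappa] at h1
  have h2 := h.kappa_pow y
  have h3 : 0 < kappa α β c a y ^ (2 * c) := pow_pos (h.kappa_pos y) _
  rw [h1] at h2
  refine (inv_eq_of_mul_eq_one_right ?_).symm
  linarith

theorem gauge_compactification_lt_one (h : IsCompactificationData α β c a) (y : Fin n → ℝ) :
    gauge α β a (compactification α β c a y) < 1 := by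
  have h1 := h.gauge_compactification y
  have h2 : 0 < (kappa α β c a y ^ (2 * c))⁻¹ := inv_pos.2 (pow_pos (h.kappa_pos y) _)
  linarith

theorem kappaX_compactification (h : IsCompactificationData α β c a) (y : Fin n → ℝ) :
    kappaX α β c a (compactification α β c a y) = kappa α β c a y := by
  have h1 := h.kappaX_pow (h.gauge_compactification_lt_one y)
  rw [h.gauge_compactification, inv_inv] at h1
  exact (pow_left_inj₀ (kappaX_pos (h.gauge_compactification_lt_one y)).le
    (h.kappa_pos y).le h.two_c_ne_zero).1 h1

theorem compactification_scale_kappaX (h : IsCompactificationData α β c a)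
    {x : Fin n → ℝ} (hx : gauge α β a x < 1) :
    compactification α β c a (scale α (kappaX α β c a x) x) = x := by
  have h0 : 0 < kappaX α β c a x := kappaX_pos hx
  have h1 : kappa α β c a (scale α (kappaX α β c a x) x) = kappaX α β c a x := by
    refine (pow_left_inj₀ (h.kappa_pos _).le h0.le h.two_c_ne_zero).1 ?_
    rw [h.kappa_pow, h.gauge_scale, h.kappaX_pow hx]
    have : (1 - gauge α β a x) ≠ 0 := by linarith
    field_simp
    ring
  ext i
  rw [compactification, h1, scale]
  field_simp

theorem compactification_mem (h : IsCompactificationData α β c a)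
    {W : Set ({i : Fin n // α i = 0} → ℝ)} {y : Fin n → ℝ}
    (hy : y ∈ admissibleDomain α W) : compactification α β c a y ∈ admissibleDomain α W := by
  rw [← scale_mem_admissibleDomain (kappa α β c a y), h.scale_kappa]
  exact hy

/-- `T_{qP}` maps `U` bijectively onto the part of `U` where `q < 1`, so the image condition reduces
to admissibility. This form shows that `𝒟` is open. -/
theorem disc_eq (h : IsCompactificationData α β c a) (W : Set ({i : Fin n // α i = 0} → ℝ)) :
    disc α β c a W = admissibleDomain α W ∩ {x | gauge α β a x < 1} := by
  ext x
  simp only [disc, mem_ofPred_eq, h.p_lt_one_iff, mem_inter_iff]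
  refine and_congr_left fun hx => ⟨?_, fun hU => ?_⟩
  · rintro ⟨y, hy, rfl⟩
    exact h.compactification_mem hy
  · exact ⟨_, (scale_mem_admissibleDomain _).2 hU, h.compactification_scale_kappaX hx⟩

theorem horizon_eq (h : IsCompactificationData α β c a) (W : Set ({i : Fin n // α i = 0} → ℝ)) :
    horizon α β c a W = admissibleDomain α W ∩ {x | gauge α β a x = 1} := by
  ext x
  simp only [horizon, mem_ofPred_eq, h.p_eq_one_iff, mem_inter_iff]

theorem closedDisc_eq (h : IsCompactificationData α β c a) (W : Set ({i : Fin n // α i = 0} → ℝ)) :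
    closedDisc α β c a W = admissibleDomain α W ∩ {x | gauge α β a x ≤ 1} := by
  rw [closedDisc, h.disc_eq, h.horizon_eq, ← inter_union_distrib_left]
  congr 1
  ext x
  simp [le_iff_lt_or_eq]

theorem compactification_mem_disc (h : IsCompactificationData α β c a)
    {W : Set ({i : Fin n // α i = 0} → ℝ)} {y : Fin n → ℝ}
    (hy : y ∈ admissibleDomain α W) : compactification α β c a y ∈ disc α β c a W := by
  rw [h.disc_eq]
  exact ⟨h.compactification_mem hy, h.gauge_compactification_lt_one y⟩

end IsCompactificationData

theorem isOpen_admissibleDomain {W : Set ({i : Fin n // α i = 0} → ℝ)} (hW : IsOpen W) :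
    IsOpen (admissibleDomain α W) :=
  hW.preimage (continuous_pi fun _ => continuous_apply _)

theorem contDiff_gauge : ContDiff ℝ ∞ (gauge α β a) := by
  unfold gauge
  fun_prop

theorem continuous_gauge : Continuous (gauge α β a) := contDiff_gauge.continuous

theorem IsCompactificationData.isOpen_disc (h : IsCompactificationData α β c a)
    {W : Set ({i : Fin n // α i = 0} → ℝ)} (hW : IsOpen W) : IsOpen (disc α β c a W) := by
  rw [h.disc_eq]
  exact (isOpen_admissibleDomain hW).inter (isOpen_lt continuous_gauge continuous_const)

end Algebra

/-! ### Evolution of `q`, `κ` and the compactified solution -/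

section Dynamics

variable {n : ℕ} {α β : Fin n → ℕ} {c : ℕ} {a : Fin n → ℝ} {k : ℕ}
  {f fα : (Fin n → ℝ) → (Fin n → ℝ)}

/-- The function `∑ β_j a_j x_j ^ (2 β_j - 1) f̃_j(x)`, which governs the growth of `κ`. -/
noncomputable def radialRate (α β : Fin n → ℕ) (c : ℕ) (a : Fin n → ℝ) (k : ℕ)
    (f fα : (Fin n → ℝ) → (Fin n → ℝ)) (x : Fin n → ℝ) : ℝ :=
  ∑ j ∈ homIndices α, β j * a j * x j ^ (2 * β j - 1) * fTilde α β c a k f fα x j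

theorem fderiv_gauge_apply (x v : Fin n → ℝ) :
    fderiv ℝ (gauge α β a) x v =
      2 * ∑ j ∈ homIndices α, β j * a j * x j ^ (2 * β j - 1) * v j := by
  have h : HasFDerivAt (gauge α β a) (∑ i ∈ homIndices α,
      a i • (((2 * β i : ℕ) * x i ^ (2 * β i - 1)) •
        (ContinuousLinearMap.proj i : (Fin n → ℝ) →L[ℝ] ℝ))) x := by
    unfold gauge
    refine HasFDerivAt.fun_sum fun i _ => HasFDerivAt.const_mul ?_ _
    have := (hasDerivAt_pow (2 * β i) (x i)).comp_hasFDerivAt x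
      (ContinuousLinearMap.proj i : (Fin n → ℝ) →L[ℝ] ℝ).hasFDerivAt
    exact this
  rw [h.fderiv, Finset.mul_sum]
  simp only [sum_apply, smul_apply,
    ContinuousLinearMap.proj_apply, smul_eq_mul]
  refine Finset.sum_congr rfl fun i _ => ?_
  push_cast
  ring

theorem hasDerivWithinAt_gauge {y : ℝ → Fin n → ℝ} {y' : Fin n → ℝ} {s : Set ℝ} {t : ℝ}
    (hy : HasDerivWithinAt y y' s t) :
    HasDerivWithinAt (fun r => gauge α β a (y r)) (fderiv ℝ (gauge α β a) (y t) y') s t :=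
  ((contDiff_gauge.differentiable (by simp)).differentiableAt.hasFDerivAt).comp_hasDerivWithinAt
    t hy

namespace IsCompactificationData

/-- On `I_α` one has `x_i / β_i = α_i x_i / c`: up to the factor `1/c` this is the generator of the
scaling, for which `q` has degree `2c`. -/
theorem fderiv_gauge_euler (h : IsCompactificationData α β c a) (x : Fin n → ℝ) :
    fderiv ℝ (gauge α β a) x (fun i => x i / β i) = 2 * gauge α β a x := by
  rw [fderiv_gauge_apply, gauge]
  congr 1
  refine Finset.sum_congr rfl fun i hi => ?_
  have h1 := h.beta_pos hi
  have h2 : (β i : ℝ) ≠ 0 := by positivity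
  obtain ⟨m, hm⟩ : ∃ m, 2 * β i = m + 1 := ⟨2 * β i - 1, by omega⟩
  rw [hm, Nat.add_sub_cancel, pow_succ]
  field_simp

/-- The part `f̃` of `g` contributes `2G`; the correction is `-G` times the Euler field and
contributes `-2Gq`. -/
theorem fderiv_gauge_desingularized (h : IsCompactificationData α β c a) (x : Fin n → ℝ) :
    fderiv ℝ (gauge α β a) x (desingularized α β c a k f fα x) =
      2 * radialRate α β c a k f fα x * (1 - gauge α β a x) := by
  have h1 : fderiv ℝ (gauge α β a) x (desingularized α β c a k f fα x) =
      fderiv ℝ (gauge α β a) x (fTilde α β c a k f fα x -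
        radialRate α β c a k f fα x • fun i => x i / β i) := by
    rw [fderiv_gauge_apply, fderiv_gauge_apply]
    congr 1
    refine Finset.sum_congr rfl fun i hi => ?_
    rw [desingularized, if_pos hi]
    rfl
  rw [h1, map_sub, map_smul, h.fderiv_gauge_euler, fderiv_gauge_apply, smul_eq_mul]
  change 2 * radialRate α β c a k f fα x - _ = _
  ring

theorem field_eq_fTilde (h : IsCompactificationData α β c a) (y : Fin n → ℝ) (j : Fin n) :
    f y j = kappa α β c a y ^ (k + α j) *
      fTilde α β c a k f fα (compactification α β c a y) j := by
  have h1 := (h.kappa_pos y).ne'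
  rw [fTilde, if_pos ((h.p_lt_one_iff _).2 (h.gauge_compactification_lt_one y)),
    h.kappaX_compactification, h.scale_kappa]
  field_simp

/-- The factor `y_j^{2β_j-1}` carries `κ^{α_j(2β_j-1)}` and `f_j` carries `κ^{k+α_j}`. As `α_j β_j =
c`, the exponents add up to `2c + k` for every `j`, so one power of `κ` comes out of the sum. -/
theorem fderiv_gauge_field (h : IsCompactificationData α β c a) (y : Fin n → ℝ) :
    fderiv ℝ (gauge α β a) y (f y) = 2 * (kappa α β c a y ^ (2 * c + k) *
      radialRate α β c a k f fα (compactification α β c a y)) := by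
  rw [fderiv_gauge_apply, radialRate]
  congr 1
  rw [Finset.mul_sum]
  refine Finset.sum_congr rfl fun j hj => ?_
  have h1 := h.beta_pos hj
  have h2 : y j = kappa α β c a y ^ α j * compactification α β c a y j :=
    (congrFun (h.scale_kappa y) j).symm
  rw [h.field_eq_fTilde (f := f) (fα := fα) (k := k) y j]
  set X := compactification α β c a y
  set K := kappa α β c a y
  rw [h2]
  have h3 : 2 * c + k = α j * (2 * β j - 1) + (k + α j) := by
    obtain ⟨m, hm⟩ : ∃ m, 2 * β j = m + 1 := ⟨2 * β j - 1, by omega⟩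
    rw [← h.mul_eq j hj, hm, Nat.add_sub_cancel]
    have : 2 * (α j * β j) = α j * (2 * β j) := by ring
    rw [this, hm]
    ring
  rw [h3, mul_pow, ← pow_mul]
  ring

variable {y : ℝ → Fin n → ℝ} {s : Set ℝ} {t : ℝ}

theorem hasDerivWithinAt_kappa (h : IsCompactificationData α β c a)
    (hy : HasDerivWithinAt y (f (y t)) s t) :
    HasDerivWithinAt (fun r => kappa α β c a (y r)) (kappa α β c a (y t) ^ (k + 1) *
      radialRate α β c a k f fα (compactification α β c a (y t)) / c) s t := by
  have hc : (c : ℝ) ≠ 0 := by have := h.c_pos; positivity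
  have h0 : 0 < 1 + gauge α β a (y t) := by linarith [h.gauge_nonneg (y t)]
  have h1 := ((hasDerivWithinAt_gauge (α := α) (β := β) (a := a) hy).const_add 1).rpow_const
    (p := 1 / (2 * c : ℝ)) (Or.inl h0.ne')
  simp only [← h.kappa_eq] at h1
  rw [h.fderiv_gauge_field (fα := fα) (k := k), Real.rpow_sub h0, Real.rpow_one, ← h.kappa_eq,
    ← h.kappa_pow] at h1
  convert h1 using 1
  have := (h.kappa_pos (y t)).ne'
  field_simp
  ring

/-- The quotient rule produces `κ^k f̃_i` and `-α_i x_i κ'/κ = -κ^k G x_i α_i/c`, and `α_i/c =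
1/β_i` on `I_α`. Off `I_α` the exponent `α_i` is zero and only the first term remains. -/
theorem hasDerivWithinAt_compactification (h : IsCompactificationData α β c a)
    (hy : HasDerivWithinAt y (f (y t)) s t) :
    HasDerivWithinAt (fun r => compactification α β c a (y r)) (kappa α β c a (y t) ^ k •
      desingularized α β c a k f fα (compactification α β c a (y t))) s t := by
  refine hasDerivWithinAt_pi.2 fun i => ?_
  have h0 := (h.kappa_pos (y t)).ne'
  have h1 := (hasDerivWithinAt_pi.1 hy i).div ((h.hasDerivWithinAt_kappa (fα := fα) (k := k)
    hy).fun_pow (α i)) (pow_ne_zero _ h0)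
  refine h1.congr_deriv ?_
  rw [h.field_eq_fTilde (f := f) (fα := fα) (k := k) (y t) i]
  have h2 : y t i = kappa α β c a (y t) ^ α i * compactification α β c a (y t) i :=
    (congrFun (h.scale_kappa (y t)) i).symm
  rw [h2, Pi.smul_apply, desingularized]
  simp only [smul_eq_mul]
  change _ = _ * (if i ∈ homIndices α then _ - radialRate α β c a k f fα _ * _ else _)
  generalize compactification α β c a (y t) = X at *
  generalize kappa α β c a (y t) = K at *
  split_ifs with hi
  · have hc : (c : ℝ) = α i * β i := by exact_mod_cast (h.mul_eq i hi).symm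
    have h3 := h.beta_pos hi
    have h4 := mem_homIndices.1 hi
    rw [hc]
    obtain ⟨m, hm⟩ : ∃ m, α i = m + 1 := ⟨α i - 1, by omega⟩
    have h5 : (m : ℝ) + 1 ≠ 0 := by positivity
    rw [hm, Nat.add_sub_cancel]
    push_cast
    field_simp
    ring
  · have : α i = 0 := by
      rw [mem_homIndices] at hi; omega
    rw [this]
    simp

/-- The exponent `-k` is the one that cancels the factor `κ^{k+1}` in `κ'`, leaving a slope that
converges at the horizon. -/
theorem hasDerivWithinAt_inv_kappa_pow (h : IsCompactificationData α β c a) (hk : 1 ≤ k)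
    (hy : HasDerivWithinAt y (f (y t)) s t) :
    HasDerivWithinAt (fun r => (kappa α β c a (y r) ^ k)⁻¹)
      (-(k / c * radialRate α β c a k f fα (compactification α β c a (y t)))) s t := by
  have h0 := (h.kappa_pos (y t)).ne'
  have hc : (c : ℝ) ≠ 0 := by have := h.c_pos; positivity
  have h1 := ((h.hasDerivWithinAt_kappa (fα := fα) (k := k) hy).fun_pow k).fun_inv
    (pow_ne_zero _ h0)
  refine h1.congr_deriv ?_
  obtain ⟨m, rfl⟩ : ∃ m, k = m + 1 := ⟨k - 1, by omega⟩
  rw [Nat.add_sub_cancel]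
  field_simp
  ring

end IsCompactificationData

end Dynamics

/-! ### Regularity of `g` inside `𝒟` and continuity of `f̃` up to the horizon -/

section Regularity

variable {n : ℕ} {α β : Fin n → ℕ} {c : ℕ} {a : Fin n → ℝ} {k : ℕ}
  {W : Set ({i : Fin n // α i = 0} → ℝ)} {f fα : (Fin n → ℝ) → (Fin n → ℝ)}

theorem scale_scale (R r : ℝ) (x : Fin n → ℝ) : scale α R (scale α r x) = scale α (R * r) x := by
  ext i
  simp only [scale]
  ring

theorem scale_one (x : Fin n → ℝ) : scale α 1 x = x := by
  ext i
  simp [scale]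

/-- Every point with a nonzero coordinate in `I_α` is rescaled to the unit sphere, with a scaling
factor controlled by the size of the coordinates. -/
theorem exists_scale_mem_sphere {x : Fin n → ℝ} {i : Fin n} (hi : i ∈ homIndices α) {δ : ℝ}
    (hδ : 0 < δ) (hxi : δ ≤ |x i|) :
    ∃ r : ℝ, 0 < r ∧ min 1 δ ≤ r ∧ r ^ 2 ≤ 1 + ∑ j ∈ homIndices α, x j ^ 2 ∧
      ∑ j ∈ homIndices α, scale α r⁻¹ x j ^ 2 = 1 := by
  -- The factor is `r = ρ⁻¹`, with `ρ` found by the intermediate value theorem: `φ` vanishes at `0`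
  -- and is at least `1` at `(min 1 δ)⁻¹`.
  set φ : ℝ → ℝ := fun ρ => ∑ j ∈ homIndices α, scale α ρ x j ^ 2 with hφ
  have hcont : Continuous φ := by
    simp only [hφ, scale]
    fun_prop
  set m := min 1 δ with hm
  have hm0 : 0 < m := lt_min one_pos hδ
  have hM1 : 1 ≤ m⁻¹ := (one_le_inv₀ hm0).2 (min_le_left _ _)
  have hzero : φ 0 = 0 := by
    refine Finset.sum_eq_zero fun j hj => ?_
    simp [scale, (mem_homIndices.1 hj).ne']
  have hone : 1 ≤ φ m⁻¹ := by
    have h1 : scale α m⁻¹ x i ^ 2 ≤ φ m⁻¹ :=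
      Finset.single_le_sum (f := fun j => scale α m⁻¹ x j ^ 2) (fun j _ => sq_nonneg _) hi
    refine le_trans ?_ h1
    rw [one_le_sq_iff_one_le_abs]
    have h2 : m⁻¹ ≤ m⁻¹ ^ α i := le_self_pow₀ hM1 (mem_homIndices.1 hi).ne'
    have h3 : m ≤ |x i| := (min_le_right _ _).trans hxi
    calc (1 : ℝ) = m⁻¹ * m := (inv_mul_cancel₀ hm0.ne').symm
      _ ≤ m⁻¹ ^ α i * |x i| := by gcongr
      _ = |scale α m⁻¹ x i| := by
        rw [scale, abs_mul, abs_of_nonneg (by positivity : (0 : ℝ) ≤ m⁻¹ ^ α i)]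
  obtain ⟨ρ, ⟨hρ0, hρM⟩, hρ⟩ := intermediate_value_Icc (by positivity : (0 : ℝ) ≤ m⁻¹)
    hcont.continuousOn
    (show (1 : ℝ) ∈ Icc (φ 0) (φ m⁻¹) from ⟨by rw [hzero]; exact zero_le_one, hone⟩)
  have hρpos : 0 < ρ := by
    rcases hρ0.eq_or_lt with h0 | h0
    · rw [← h0, hzero] at hρ
      exact absurd hρ zero_ne_one
    · exact h0
  refine ⟨ρ⁻¹, inv_pos.2 hρpos, ?_, ?_, by rw [inv_inv]; exact hρ⟩
  · exact (le_inv_comm₀ hρpos hm0).1 hρM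
  · set B := ∑ j ∈ homIndices α, x j ^ 2 with hB
    have hB0 : 0 ≤ B := Finset.sum_nonneg fun j _ => sq_nonneg _
    -- If `ρ ≥ 1` then `r ≤ 1`. If `ρ ≤ 1` then `ρ^{α_j} ≤ ρ`, because `α_j ≥ 1`, so `1 ≤ ρ² B` and
    -- `r² ≤ B`.
    rcases le_total 1 ρ with h1 | h1
    · have : ρ⁻¹ ≤ 1 := inv_le_one_of_one_le₀ h1
      nlinarith [inv_pos.2 hρpos]
    · have h2 : (1 : ℝ) ≤ ρ ^ 2 * B := by
        rw [← hρ, hB, Finset.mul_sum]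
        refine Finset.sum_le_sum fun j hj => ?_
        rw [scale, mul_pow]
        have h3 : ρ ^ α j ≤ ρ := pow_le_of_le_one hρ0 h1 (mem_homIndices.1 hj).ne'
        have h4 : 0 ≤ ρ ^ α j := by positivity
        gcongr
      rw [inv_pow]
      have h5 : 0 < ρ ^ 2 := by positivity
      have h6 : (ρ ^ 2)⁻¹ ≤ B := by
        rw [inv_le_iff_one_le_mul₀ h5]
        linarith
      linarith

namespace IsCompactificationData

theorem contDiffOn_fTilde (h : IsCompactificationData α β c a)
    (hf : IsAsymptoticallyQuasiHomogeneous α k W f fα) :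
    ContDiffOn ℝ 1 (fTilde α β c a k f fα) (disc α β c a W) := by
  have hgauge : ∀ x ∈ disc α β c a W, gauge α β a x < 1 := fun x hx => by
    rw [h.disc_eq] at hx; exact hx.2
  have hκ : ContDiffOn ℝ 1 (kappaX α β c a) (disc α β c a W) := by
    have : ContDiffOn ℝ 1 (fun x => 1 - gauge α β a x) (disc α β c a W) :=
      (contDiff_const.sub (contDiff_gauge.of_le (by simp))).contDiffOn
    exact this.rpow_const_of_ne fun x hx => by linarith [hgauge x hx]
  have hs : ContDiffOn ℝ 1 (fun x => scale α (kappaX α β c a x) x) (disc α β c a W) := by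
    refine contDiffOn_pi.2 fun i => ?_
    exact (hκ.pow _).mul (contDiff_apply ℝ ℝ i).contDiffOn
  have hfs : ContDiffOn ℝ 1 (fun x => f (scale α (kappaX α β c a x) x)) (disc α β c a W) :=
    (hf.smooth.of_le (by simp)).comp hs fun x hx => by
      rw [h.disc_eq] at hx
      exact (scale_mem_admissibleDomain _).2 hx.1
  refine contDiffOn_pi.2 fun j => ?_
  have : ContDiffOn ℝ 1 (fun x => (kappaX α β c a x ^ (k + α j))⁻¹ *
      f (scale α (kappaX α β c a x) x) j) (disc α β c a W) :=
    ((hκ.pow _).inv fun x hx => pow_ne_zero _ (kappaX_pos (hgauge x hx)).ne').mul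
      (contDiffOn_pi.1 hfs j)
  refine this.congr fun x hx => ?_
  rw [fTilde, if_pos ((h.p_lt_one_iff x).2 (hgauge x hx))]

theorem contDiffOn_desingularized (h : IsCompactificationData α β c a)
    (hf : IsAsymptoticallyQuasiHomogeneous α k W f fα) :
    ContDiffOn ℝ 1 (desingularized α β c a k f fα) (disc α β c a W) := by
  have hj := contDiffOn_pi.1 (h.contDiffOn_fTilde hf)
  refine contDiffOn_pi.2 fun i => ?_
  simp only [desingularized]
  split_ifs with hi
  · refine (hj i).sub (ContDiffOn.mul (ContDiffOn.sum fun j _ => ContDiffOn.mul ?_ (hj j)) ?_)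
    · exact ContDiff.contDiffOn (by fun_prop)
    · exact ContDiff.contDiffOn (by fun_prop)
  · exact hj i

/-- With `x = scale r w` and `w` on the sphere, the difference is exactly `r^{k+α_j}` times the
asymptotic remainder at `w` with parameter `R = κ r`. -/
theorem abs_fTilde_sub_le (h : IsCompactificationData α β c a)
    (hf : IsAsymptoticallyQuasiHomogeneous α k W f fα) {x : Fin n → ℝ}
    (hx : x ∈ disc α β c a W) {r ε : ℝ} (hr : 0 < r)
    (hsph : ∑ j ∈ homIndices α, scale α r⁻¹ x j ^ 2 = 1) (j : Fin n)
    (hε : ∀ w ∈ sphereDomain α W, |((kappaX α β c a x * r) ^ (k + α j))⁻¹ *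
      (f (scale α (kappaX α β c a x * r) w) j -
        (kappaX α β c a x * r) ^ (k + α j) * fα w j)| ≤ ε) :
    |fTilde α β c a k f fα x j - fα x j| ≤ r ^ (k + α j) * ε := by
  rw [h.disc_eq] at hx
  have hκ : 0 < kappaX α β c a x := kappaX_pos hx.2
  set w := scale α r⁻¹ x with hw
  have hwU : w ∈ admissibleDomain α W := (scale_mem_admissibleDomain _).2 hx.1
  have hxw : scale α r w = x := by
    rw [hw, scale_scale, mul_inv_cancel₀ hr.ne', scale_one]
  have h1 := hε w ⟨hwU, hsph⟩
  have h2 : fα x j = r ^ (k + α j) * fα w j := by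
    rw [← hf.quasiHomogeneous.homogeneous w hwU r j, hxw]
  rw [fTilde, if_pos ((h.p_lt_one_iff x).2 hx.2), h2]
  rw [← scale_scale, hxw] at h1
  set K := kappaX α β c a x
  have h3 : (K ^ (k + α j))⁻¹ * f (scale α K x) j - r ^ (k + α j) * fα w j =
      r ^ (k + α j) * (((K * r) ^ (k + α j))⁻¹ *
        (f (scale α K x) j - (K * r) ^ (k + α j) * fα w j)) := by
    rw [mul_pow]
    have := hκ.ne'
    field_simp
  rw [h3, abs_mul, abs_of_pos (pow_pos hr _)]
  exact mul_le_mul_of_nonneg_left h1 (pow_pos hr _).le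

theorem exists_coord_ne_zero (h : IsCompactificationData α β c a) {x : Fin n → ℝ}
    (hx : gauge α β a x = 1) : ∃ i ∈ homIndices α, x i ≠ 0 := by
  by_contra hne
  push Not at hne
  have : gauge α β a x = 0 := by
    refine Finset.sum_eq_zero fun i hi => ?_
    rw [hne i hi, zero_pow (by have := h.beta_pos hi; omega), mul_zero]
  linarith

theorem tendsto_kappaX (h : IsCompactificationData α β c a) {x : Fin n → ℝ}
    (hx : gauge α β a x = 1) : Tendsto (kappaX α β c a) (𝓝[{x | gauge α β a x < 1}] x) atTop := by
  have h1 : Tendsto (fun z => 1 - gauge α β a z) (𝓝[{x | gauge α β a x < 1}] x) (𝓝[>] 0) := by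
    refine tendsto_nhdsWithin_iff.2 ⟨?_, ?_⟩
    · have : Tendsto (fun z => 1 - gauge α β a z) (𝓝 x) (𝓝 (1 - gauge α β a x)) :=
        (continuous_const.sub continuous_gauge).continuousAt
      rw [hx, sub_self] at this
      exact this.mono_left nhdsWithin_le_nhds
    · filter_upwards [self_mem_nhdsWithin] with z hz
      have hz' : gauge α β a z < 1 := hz
      exact sub_pos.2 hz'
  have h2 := tendsto_rpow_neg_nhdsGT_zero (y := -(1 / (2 * c : ℝ)))
    (by have := h.two_c_pos; simp only [Left.neg_neg_iff]; positivity)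
  exact h2.comp h1

/-- The asymptotic hypothesis concerns the Euclidean sphere, not `p = 1`, so nearby points are first
rescaled to it. A nonzero coordinate of `x` in `I_α` keeps `r` away from `0`, whence `κ r → ∞`, and
local boundedness keeps `r^{k+α_j}` bounded. Uniformity is essential because the point on the sphere
varies. -/
theorem continuousWithinAt_fTilde_horizon (h : IsCompactificationData α β c a) (hW : IsOpen W)
    (hf : IsAsymptoticallyQuasiHomogeneous α k W f fα) {x : Fin n → ℝ}
    (hx : x ∈ horizon α β c a W) (j : Fin n) :
    ContinuousWithinAt (fun z => fTilde α β c a k f fα z j) (disc α β c a W) x := by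
  have hx' := hx
  rw [h.horizon_eq] at hx'
  obtain ⟨hxU, hx1⟩ := hx'
  obtain ⟨i, hi, hxi⟩ := h.exists_coord_ne_zero hx1
  have hfx : fTilde α β c a k f fα x j = fα x j := by
    rw [fTilde, if_neg (by rw [hx.2]; exact lt_irrefl _)]
  have hfα : Tendsto (fun z => fα z j) (𝓝[disc α β c a W] x) (𝓝 (fα x j)) := by
    have h1 : ContinuousAt fα x := hf.quasiHomogeneous.smooth.continuousOn.continuousAt
      ((isOpen_admissibleDomain hW).mem_nhds hxU)
    exact ((continuous_apply j).continuousAt.comp h1).tendsto.mono_left nhdsWithin_le_nhds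
  have hdiff : Tendsto (fun z => fTilde α β c a k f fα z j - fα z j)
      (𝓝[disc α β c a W] x) (𝓝 0) := by
    set δ := |x i| / 2 with hδ
    have hδ0 : 0 < δ := by positivity
    set B := 2 + ∑ j ∈ homIndices α, x j ^ 2 with hB
    have hB1 : 1 ≤ B := by
      have : 0 ≤ ∑ j ∈ homIndices α, x j ^ 2 := Finset.sum_nonneg fun j _ => sq_nonneg _
      linarith
    have e1 : ∀ᶠ z in 𝓝[disc α β c a W] x, δ ≤ |z i| := by
      have hc : ContinuousAt (fun z : Fin n → ℝ => |z i|) x :=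
        (continuous_abs.comp (continuous_apply i)).continuousAt
      have : δ < |x i| := by
        have := abs_pos.2 hxi
        rw [hδ]; linarith
      exact ((hc.eventually (lt_mem_nhds this)).mono fun z hz => le_of_lt hz).filter_mono
        nhdsWithin_le_nhds
    have e2 : ∀ᶠ z in 𝓝[disc α β c a W] x, 1 + ∑ j ∈ homIndices α, z j ^ 2 < B := by
      have hc : Continuous (fun z : Fin n → ℝ => 1 + ∑ j ∈ homIndices α, z j ^ 2) := by fun_prop
      exact (hc.continuousAt.eventually (gt_mem_nhds (by rw [hB]; linarith))).filter_mono
        nhdsWithin_le_nhds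
    have e3 : Tendsto (kappaX α β c a) (𝓝[disc α β c a W] x) atTop := by
      refine (h.tendsto_kappaX hx1).mono_left (nhdsWithin_mono _ ?_)
      rw [h.disc_eq]
      exact inter_subset_right
    refine Metric.tendsto_nhds.2 fun ε hε => ?_
    have hBp : 0 < B ^ (k + α j) := by positivity
    obtain ⟨R₀, hR₀⟩ := eventually_atTop.1
      (Metric.tendstoUniformlyOn_iff.1 (hf.tendsto j) (ε / (2 * B ^ (k + α j))) (by positivity))
    have hm0 : 0 < min 1 δ := lt_min one_pos hδ0
    filter_upwards [e1, e2, e3.eventually_ge_atTop (|R₀| / min 1 δ), self_mem_nhdsWithin]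
      with z hz1 hz2 hz3 hzd
    obtain ⟨r, hr0, hrm, hrB, hsph⟩ := exists_scale_mem_sphere hi hδ0 hz1
    have hrB' : r ≤ B := by
      have : r ^ 2 ≤ B ^ 2 := by nlinarith
      exact (pow_le_pow_iff_left₀ hr0.le (by linarith) two_ne_zero).1 this
    have hK : R₀ ≤ kappaX α β c a z * r := by
      rw [div_le_iff₀ hm0] at hz3
      have hκ : 0 < kappaX α β c a z := by
        rw [h.disc_eq] at hzd
        exact kappaX_pos hzd.2
      calc R₀ ≤ |R₀| := le_abs_self _
        _ ≤ kappaX α β c a z * min 1 δ := hz3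
        _ ≤ kappaX α β c a z * r := by gcongr
    have h1 := h.abs_fTilde_sub_le hf hzd hr0 hsph j (ε := ε / (2 * B ^ (k + α j)))
      fun w hw => by
        have h2 := (hR₀ _ hK w hw).le
        rwa [Real.dist_eq, zero_sub, abs_neg] at h2
    rw [Real.dist_eq, sub_zero]
    calc _ ≤ r ^ (k + α j) * (ε / (2 * B ^ (k + α j))) := h1
      _ ≤ B ^ (k + α j) * (ε / (2 * B ^ (k + α j))) := by gcongr
      _ = ε / 2 := by field_simp
      _ < ε := by linarith
  have := hdiff.add hfα
  rw [ContinuousWithinAt, hfx]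
  simpa using this

theorem continuousOn_fTilde (h : IsCompactificationData α β c a) (hW : IsOpen W)
    (hf : IsAsymptoticallyQuasiHomogeneous α k W f fα) (j : Fin n) :
    ContinuousOn (fun z => fTilde α β c a k f fα z j) (closedDisc α β c a W) := by
  rintro x (hx | hx)
  · refine ContinuousAt.continuousWithinAt ?_
    exact (contDiffOn_pi.1 (h.contDiffOn_fTilde hf) j).continuousOn.continuousAt
      ((h.isOpen_disc hW).mem_nhds hx)
  · refine (h.continuousWithinAt_fTilde_horizon hW hf hx j).union ?_
    have hfα : ContinuousOn (fun z => fα z j) (horizon α β c a W) :=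
      (continuousOn_pi.1 hf.quasiHomogeneous.smooth.continuousOn j).mono fun z hz => hz.1
    refine (hfα.congr fun z hz => ?_) x hx
    simp only [fTilde, if_neg (show ¬ p α β c a z < 1 by rw [hz.2]; exact lt_irrefl _)]

theorem continuousOn_radialRate (h : IsCompactificationData α β c a) (hW : IsOpen W)
    (hf : IsAsymptoticallyQuasiHomogeneous α k W f fα) :
    ContinuousOn (radialRate α β c a k f fα) (closedDisc α β c a W) := by
  unfold radialRate
  refine continuousOn_finsetSum _ fun j _ => ContinuousOn.mul ?_ (h.continuousOn_fTilde hW hf j)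
  exact Continuous.continuousOn (by fun_prop)

end IsCompactificationData

end Regularity

/-! ### The radial rate as an eigenvalue of the Jacobian -/

section Equilibrium

variable {n : ℕ} {α β : Fin n → ℕ} {c : ℕ} {a : Fin n → ℝ} {k : ℕ}
  {W : Set ({i : Fin n // α i = 0} → ℝ)} {f fα : (Fin n → ℝ) → (Fin n → ℝ)}

theorem zero_mem_eigenvaluesC {J : Matrix (Fin n) (Fin n) ℝ} (hJ : J.det = 0) :
    (0 : ℂ) ∈ eigenvaluesC J := by
  rw [eigenvaluesC, Polynomial.mem_roots (Matrix.charpoly_monic _).ne_zero, Polynomial.IsRoot.def,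
    Matrix.eval_charpoly]
  have h1 : (J.map (algebraMap ℝ ℂ)).det = 0 := by
    rw [← RingHom.mapMatrix_apply, ← RingHom.map_det, hJ, map_zero]
  rw [map_zero, zero_sub, Matrix.det_neg, h1, mul_zero]

/-- A real linear map whose range is annihilated by a nonzero functional has a singular matrix. -/
theorem det_toMatrix'_eq_zero_of_comp_eq_zero {L : (Fin n → ℝ) →ₗ[ℝ] (Fin n → ℝ)}
    {ℓ : (Fin n → ℝ) →ₗ[ℝ] ℝ} (hℓ : ℓ ≠ 0) (h : ∀ v, ℓ (L v) = 0) :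
    (LinearMap.toMatrix' L).det = 0 := by
  rw [LinearMap.det_toMatrix']
  by_contra hdet
  refine hℓ (LinearMap.ext fun w => ?_)
  have hu : IsUnit (LinearMap.det L) := isUnit_iff_ne_zero.2 hdet
  obtain ⟨v, rfl⟩ := (LinearEquiv.ofIsUnitDet
    (v := Pi.basisFun ℝ (Fin n)) (v' := Pi.basisFun ℝ (Fin n)) (f := L)
    (by rwa [← LinearMap.det_toLin (Pi.basisFun ℝ (Fin n)), Matrix.toLin_toMatrix])).surjective w
  exact h v

namespace IsCompactificationData

theorem convexOn_gauge (h : IsCompactificationData α β c a) :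
    ConvexOn ℝ univ (gauge α β a) := by
  refine ⟨convex_univ, fun x _ z _ r s hr hs hrs => ?_⟩
  simp only [gauge, Finset.smul_sum, ← Finset.sum_add_distrib]
  refine Finset.sum_le_sum fun i _ => ?_
  have h1 := (Even.convexOn_pow (𝕜 := ℝ) (even_two_mul (β i))).2 (mem_univ (x i))
    (mem_univ (z i)) hr hs hrs
  have h2 : (0 : ℝ) ≤ a i := by linarith [h.one_le_a i]
  have h3 := mul_le_mul_of_nonneg_left h1 h2
  simp only [Pi.add_apply, Pi.smul_apply, smul_eq_mul] at h3 ⊢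
  linarith

/-- The set `{q ≤ 1}` is convex with nonempty interior, and the set in question is a relatively open
piece of it. This makes derivatives at horizon points well determined. -/
theorem uniqueDiffWithinAt_inter_closedDisc (h : IsCompactificationData α β c a) (hW : IsOpen W)
    {O : Set (Fin n → ℝ)} (hO : IsOpen O) {x : Fin n → ℝ}
    (hx : x ∈ O ∩ closedDisc α β c a W) :
    UniqueDiffWithinAt ℝ (O ∩ closedDisc α β c a W) x := by
  rw [h.closedDisc_eq] at hx ⊢
  have hconv : Convex ℝ {x | gauge α β a x ≤ 1} := by
    simpa using h.convexOn_gauge.convex_le 1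
  have hinterior : (interior {x | gauge α β a x ≤ 1}).Nonempty := by
    have h0 : gauge α β a 0 = 0 := Finset.sum_eq_zero fun i hi => by
      rw [Pi.zero_apply, zero_pow (by have := h.beta_pos hi; omega), mul_zero]
    refine ⟨0, mem_interior.2 ⟨{x | gauge α β a x < 1}, fun z hz => ?_,
      isOpen_lt continuous_gauge continuous_const, ?_⟩⟩
    · exact le_of_lt (show gauge α β a z < 1 from hz)
    · change gauge α β a 0 < 1
      rw [h0]; exact one_pos
  have h1 : UniqueDiffWithinAt ℝ {x | gauge α β a x ≤ 1} x :=
    uniqueDiffWithinAt_convex hconv hinterior (subset_closure hx.2.2)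
  rw [← inter_assoc, inter_comm]
  exact h1.inter ((hO.inter (isOpen_admissibleDomain hW)).mem_nhds ⟨hx.1, hx.2.1⟩)

/-- Both sides of `Dq · g = 2G(1 - q)` are differentiated at `x`: on the left `g(x) = 0` removes the
second derivative of `q`, on the right `1 - q(x) = 0` removes any derivative of `G`. -/
theorem fderiv_gauge_comp_fderivWithin (h : IsCompactificationData α β c a) (hW : IsOpen W)
    (hf : IsAsymptoticallyQuasiHomogeneous α k W f fα) {x : Fin n → ℝ}
    (hx : IsEquilibriumAtInfinity α β c a W k f fα x) {O : Set (Fin n → ℝ)} (hO : IsOpen O)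
    (hxO : x ∈ O)
    (hg : DifferentiableWithinAt ℝ (desingularized α β c a k f fα)
      (O ∩ closedDisc α β c a W) x) (v : Fin n → ℝ) :
    fderiv ℝ (gauge α β a) x
        (fderivWithin ℝ (desingularized α β c a k f fα) (O ∩ closedDisc α β c a W) x v) =
      -(2 * radialRate α β c a k f fα x) * fderiv ℝ (gauge α β a) x v := by
  set V := O ∩ closedDisc α β c a W with hV
  set g := desingularized α β c a k f fα with hgdef
  have hxD : x ∈ closedDisc α β c a W := Or.inr hx.1
  have hxV : x ∈ V := ⟨hxO, hxD⟩
  have hx1 : gauge α β a x = 1 := (h.p_eq_one_iff x).1 hx.1.2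
  have hq : HasFDerivAt (gauge α β a) (fderiv ℝ (gauge α β a) x) x :=
    ((contDiff_gauge.differentiable (by simp)) x).hasFDerivAt
  have hdq : DifferentiableAt ℝ (fderiv ℝ (gauge α β a)) x :=
    ((contDiff_infty_iff_fderiv.1 contDiff_gauge).2.differentiable (by simp)) x
  have h1 : HasFDerivWithinAt (fun z => fderiv ℝ (gauge α β a) z (g z))
      ((fderiv ℝ (gauge α β a) x).comp (fderivWithin ℝ g V x)) V x := by
    have := hdq.hasFDerivAt.hasFDerivWithinAt.clm_apply hg.hasFDerivWithinAt
    rw [show g x = 0 from hx.2] at this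
    simpa using this
  -- Continuity of `G` suffices for this product: `(G(z) - G(x))(1 - q(z))` is `o(1) · O(z - x)`.
  have h2 : HasFDerivWithinAt (fun z => 2 * radialRate α β c a k f fα z * (1 - gauge α β a z))
      ((2 * radialRate α β c a k f fα x) • -(fderiv ℝ (gauge α β a) x)) V x := by
    have hcont : ContinuousWithinAt (radialRate α β c a k f fα) V x :=
      (h.continuousOn_radialRate hW hf x hxD).mono inter_subset_right
    have hq' : HasFDerivWithinAt (fun z => 1 - gauge α β a z) (-(fderiv ℝ (gauge α β a) x)) V x :=
      (hq.const_sub 1).hasFDerivWithinAt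
    rw [hasFDerivWithinAt_iff_isLittleO] at hq' ⊢
    have hsmall : (fun z => 2 * (radialRate α β c a k f fα z - radialRate α β c a k f fα x))
        =o[𝓝[V] x] (fun _ => (1 : ℝ)) := by
      rw [isLittleO_one_iff]
      have := (hcont.tendsto.sub_const (radialRate α β c a k f fα x)).const_mul 2
      simpa using this
    have hbig : (fun z => 1 - gauge α β a z) =O[𝓝[V] x] fun z => z - x := by
      have := (hq.const_sub 1).hasFDerivWithinAt.isBigO_sub (s := V)
      simpa [hx1] using this
    have hs1 := hsmall.mul_isBigO hbig.norm_right
    have hs2 := hq'.const_mul_left (2 * radialRate α β c a k f fα x)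
    have hs3 : (fun z => 2 * (radialRate α β c a k f fα z - radialRate α β c a k f fα x) *
        (1 - gauge α β a z)) =o[𝓝[V] x] fun z => z - x := by
      simpa using hs1
    refine (hs3.add hs2).congr_left fun z => ?_
    rw [hx1]
    simp only [smul_apply, neg_apply, smul_eq_mul]
    ring
  have h3 : HasFDerivWithinAt (fun z => fderiv ℝ (gauge α β a) z (g z))
      ((2 * radialRate α β c a k f fα x) • -(fderiv ℝ (gauge α β a) x)) V x := by
    simpa only [hgdef, h.fderiv_gauge_desingularized] using h2
  have h4 := (h.uniqueDiffWithinAt_inter_closedDisc hW hO hxV).eq h1 h3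
  have h5 := DFunLike.congr_fun h4 v
  rw [ContinuousLinearMap.comp_apply] at h5
  rw [h5]
  simp

/-- The radial rate does not vanish at a hyperbolic equilibrium at infinity: up to the factor `-2`,
it is an eigenvalue of the Jacobian matrix. -/
theorem radialRate_ne_zero (h : IsCompactificationData α β c a) (hW : IsOpen W)
    (hf : IsAsymptoticallyQuasiHomogeneous α k W f fα) {x : Fin n → ℝ}
    (hx : IsEquilibriumAtInfinity α β c a W k f fα x) {O : Set (Fin n → ℝ)} (hO : IsOpen O)
    (hxO : x ∈ O)
    (hg : DifferentiableWithinAt ℝ (desingularized α β c a k f fα)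
      (O ∩ closedDisc α β c a W) x)
    (hhyp : IsHyperbolicMatrix (jacobianWithin (desingularized α β c a k f fα)
      (O ∩ closedDisc α β c a W) x)) :
    radialRate α β c a k f fα x ≠ 0 := by
  intro h0
  have hx1 : gauge α β a x = 1 := (h.p_eq_one_iff x).1 hx.1.2
  -- On the horizon Euler's identity gives `Dq` the value `2` at `x_i / β_i`.
  have hℓ : ((fderiv ℝ (gauge α β a) x : (Fin n → ℝ) →L[ℝ] ℝ) : (Fin n → ℝ) →ₗ[ℝ] ℝ) ≠ 0 := by
    intro hz
    have h1 := h.fderiv_gauge_euler x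
    have h2 := DFunLike.congr_fun hz (fun i => x i / β i)
    simp only [ContinuousLinearMap.coe_coe, LinearMap.zero_apply] at h2
    rw [h2, hx1] at h1
    norm_num at h1
  refine hhyp 0 (zero_mem_eigenvaluesC (det_toMatrix'_eq_zero_of_comp_eq_zero hℓ fun v => ?_)) rfl
  have := h.fderiv_gauge_comp_fderivWithin hW hf hx hO hxO hg v
  rw [h0] at this
  simpa using this

end IsCompactificationData

end Equilibrium

/-! ### Uniqueness and continuation for ordinary differential equations -/

section ODE

variable {n : ℕ}

/-- Uniqueness for `u' = lam(t) g(u)` with `g` of class `C^1` on an open set. -/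
theorem eqOn_of_hasDerivWithinAt_smul {g : (Fin n → ℝ) → (Fin n → ℝ)} {D : Set (Fin n → ℝ)}
    (hD : IsOpen D) (hg : ContDiffOn ℝ 1 g D) {lam : ℝ → ℝ} {t₀ t₁ : ℝ}
    (hlam : ContinuousOn lam (Icc t₀ t₁)) {u v : ℝ → Fin n → ℝ}
    (hu : ContinuousOn u (Icc t₀ t₁)) (hv : ContinuousOn v (Icc t₀ t₁))
    (huD : ∀ t ∈ Icc t₀ t₁, u t ∈ D) (hvD : ∀ t ∈ Icc t₀ t₁, v t ∈ D)
    (hu' : ∀ t ∈ Ico t₀ t₁, HasDerivWithinAt u (lam t • g (u t)) (Ici t) t)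
    (hv' : ∀ t ∈ Ico t₀ t₁, HasDerivWithinAt v (lam t • g (v t)) (Ici t) t)
    (h0 : u t₀ = v t₀) : EqOn u v (Icc t₀ t₁) := by
  -- The two trajectories form a compact subset of `D`, on which the locally Lipschitz `g` has a
  -- single Lipschitz constant.
  set S := u '' Icc t₀ t₁ ∪ v '' Icc t₀ t₁ with hS
  have hSc : IsCompact S := (isCompact_Icc.image_of_continuousOn hu).union
    (isCompact_Icc.image_of_continuousOn hv)
  have hSD : S ⊆ D := union_subset (image_subset_iff.2 huD) (image_subset_iff.2 hvD)
  have hloc : LocallyLipschitzOn S g := fun x hx => by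
    obtain ⟨K, t, ht, hK⟩ := (hg.contDiffAt (hD.mem_nhds (hSD hx))).exists_lipschitzOnWith
    exact ⟨K, t, mem_nhdsWithin_of_mem_nhds ht, hK⟩
  obtain ⟨K, hK⟩ := hloc.exists_lipschitzOnWith_of_compact hSc
  obtain ⟨M, hM⟩ := isCompact_Icc.exists_bound_of_continuousOn hlam
  have hlip : ∀ t ∈ Ico t₀ t₁, LipschitzOnWith (M.toNNReal * K) (fun z => lam t • g z) S := by
    intro t ht
    refine LipschitzOnWith.of_dist_le_mul fun x hx z hz => ?_
    have h1 := hK.dist_le_mul x hx z hz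
    have h2 := (hM t (Ico_subset_Icc_self ht)).trans (Real.le_coe_toNNReal M)
    rw [dist_smul₀, NNReal.coe_mul, mul_assoc]
    gcongr
  exact ODE_solution_unique_of_mem_Icc_right (s := fun _ => S) hlip hu hu'
    (fun t ht => Or.inl (mem_image_of_mem u (Ico_subset_Icc_self ht))) hv hv'
    (fun t ht => Or.inr (mem_image_of_mem v (Ico_subset_Icc_self ht))) h0

/-- A solution with finite maximal existence time has no limit inside the domain. -/
theorem IsMaximalSolution.not_tendsto {f : (Fin n → ℝ) → (Fin n → ℝ)} {U : Set (Fin n → ℝ)}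
    (hU : IsOpen U) (hf : ContDiffOn ℝ 1 f U) {y : ℝ → Fin n → ℝ} {t₀ T : ℝ}
    (hy : IsMaximalSolution f U y t₀ T) {y₁ : Fin n → ℝ} (hy₁ : y₁ ∈ U) :
    ¬ Tendsto y (𝓝[<] T) (𝓝 y₁) := by
  intro hlim
  have ht₀T : t₀ < T := EReal.coe_lt_coe_iff.1 hy.lt
  have hfy : ContDiffAt ℝ 1 f y₁ := hf.contDiffAt (hU.mem_nhds hy₁)
  obtain ⟨γ, hγT, ε₀, hε₀, hγ⟩ :=
    hfy.exists_forall_mem_closedBall_exists_eq_forall_mem_Ioo_hasDerivAt₀ T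
  have hγc : ContinuousAt γ T := (hγ T ⟨by linarith, by linarith⟩).continuousAt
  have hγU : ∀ᶠ t in 𝓝 T, γ t ∈ U := hγc.eventually (by rw [hγT]; exact hU.mem_nhds hy₁)
  obtain ⟨ε₁, hε₁, hball⟩ := Metric.eventually_nhds_iff.1 hγU
  set ε := min ε₀ ε₁ with hε
  have hεpos : 0 < ε := lt_min hε₀ hε₁
  classical
  -- Gluing `y` to the local solution through `y₁` at time `T` gives a longer solution. At `T` its
  -- left derivative is the limit of `f(y)`, namely `f(y₁)`, which agrees with the right one.
  set z : ℝ → Fin n → ℝ := fun t => if t < T then y t else γ t with hz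
  have hzlt : ∀ t, t < T → z t = y t := fun t ht => if_pos ht
  have hzge : ∀ t, T ≤ t → z t = γ t := fun t ht => if_neg (not_lt.2 ht)
  have hzT : z T = y₁ := by rw [hzge T le_rfl, hγT]
  have hyAt : ∀ t, t₀ < t → t < T → HasDerivAt y (f (y t)) t := fun t h1 h2 =>
    (hy.solution t h1.le (EReal.coe_lt_coe_iff.2 h2)).2.hasDerivAt (Ici_mem_nhds h1)
  have hzAt : ∀ t, t₀ < t → t < T → HasDerivAt z (f (y t)) t := fun t h1 h2 =>
    (hyAt t h1 h2).congr_of_eventuallyEq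
      (by filter_upwards [Iio_mem_nhds h2] with r hr using hzlt r hr)
  have hleft : HasDerivWithinAt z (f y₁) (Iic T) T := by
    refine hasDerivWithinAt_Iic_of_tendsto_deriv (s := Ioo t₀ T)
      (fun t ht => (hzAt t ht.1 ht.2).differentiableAt.differentiableWithinAt) ?_
      (Ioo_mem_nhdsLT ht₀T) ?_
    · rw [ContinuousWithinAt, hzT]
      refine (hlim.mono_left (nhdsWithin_mono _ fun t ht => ht.2)).congr' ?_
      filter_upwards [self_mem_nhdsWithin] with t ht using (hzlt t ht.2).symm
    · refine (hfy.continuousAt.tendsto.comp hlim).congr' ?_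
      filter_upwards [Ioo_mem_nhdsLT ht₀T] with t ht using (hzAt t ht.1 ht.2).deriv.symm
  have hright : HasDerivWithinAt z (f y₁) (Ici T) T := by
    have h1 := (hγ T ⟨by linarith, by linarith⟩).hasDerivWithinAt (s := Ici T)
    rw [hγT] at h1
    exact h1.congr (fun t ht => hzge t ht) (hzge T le_rfl)
  have hzsol : IsSolutionOn f U z t₀ ((T + ε : ℝ) : EReal) := by
    intro t ht1 ht2
    have ht2' : t < T + ε := EReal.coe_lt_coe_iff.1 ht2
    rcases lt_trichotomy t T with h | h | h
    · have h1 := hy.solution t ht1 (EReal.coe_lt_coe_iff.2 h)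
      rw [hzlt t h]
      refine ⟨h1.1, h1.2.congr_of_eventuallyEq ?_ (hzlt t h)⟩
      filter_upwards [mem_nhdsWithin_of_mem_nhds (Iio_mem_nhds h)] with r hr using hzlt r hr
    · subst h
      rw [hzT]
      refine ⟨hy₁, HasDerivAt.hasDerivWithinAt ?_⟩
      have := hleft.union hright
      rwa [Iic_union_Ici, hasDerivWithinAt_univ] at this
    · have h1 : dist t T < ε := by rw [Real.dist_eq, abs_of_pos (by linarith)]; linarith
      rw [hzge t h.le]
      refine ⟨hball (h1.trans_le (min_le_right _ _)), HasDerivAt.hasDerivWithinAt ?_⟩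
      have h2 : ε ≤ ε₀ := min_le_left _ _
      refine (hγ t ⟨by linarith, by linarith⟩).congr_of_eventuallyEq ?_
      filter_upwards [Ioi_mem_nhds h] with r hr using hzge r (le_of_lt hr)
  have := hy.maximal _ z hzsol fun t _ h2 => hzlt t (EReal.coe_lt_coe_iff.1 h2)
  have := EReal.coe_le_coe_iff.1 this
  linarith

end ODE

/-! ### Orbits of `g` starting off the horizon -/

section StableSet

variable {n : ℕ} {α β : Fin n → ℕ} {c : ℕ} {a : Fin n → ℝ} {k : ℕ}
  {W : Set ({i : Fin n // α i = 0} → ℝ)} {f fα : (Fin n → ℝ) → (Fin n → ℝ)}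

namespace IsCompactificationData

theorem hasDerivWithinAt_one_sub_gauge (h : IsCompactificationData α β c a)
    {x : ℝ → Fin n → ℝ} {s : Set ℝ} {τ : ℝ}
    (hx : HasDerivWithinAt x (desingularized α β c a k f fα (x τ)) s τ) :
    HasDerivWithinAt (fun σ => 1 - gauge α β a (x σ))
      (-(2 * radialRate α β c a k f fα (x τ)) * (1 - gauge α β a (x τ))) s τ := by
  refine ((hasDerivWithinAt_gauge (α := α) (β := β) (a := a) hx).const_sub 1).congr_deriv ?_
  rw [h.fderiv_gauge_desingularized]
  ring

/-- A solution of the desingularized system that starts off the horizon never reaches it. -/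
theorem mem_disc_of_solution (h : IsCompactificationData α β c a) (hW : IsOpen W)
    (hf : IsAsymptoticallyQuasiHomogeneous α k W f fα) {x : ℝ → Fin n → ℝ}
    (hx0 : x 0 ∈ disc α β c a W)
    (hx : ∀ τ, 0 ≤ τ → x τ ∈ closedDisc α β c a W ∧
      HasDerivWithinAt x (desingularized α β c a k f fα (x τ)) (Ici 0) τ)
    {τ : ℝ} (hτ : 0 ≤ τ) : x τ ∈ disc α β c a W := by
  have hxc : ContinuousOn x (Icc 0 τ) := fun σ hσ =>
    (hx σ hσ.1).2.continuousWithinAt.mono Icc_subset_Ici_self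
  have hG : ContinuousOn (fun σ => radialRate α β c a k f fα (x σ)) (Icc 0 τ) :=
    (h.continuousOn_radialRate hW hf).comp hxc fun σ hσ => (hx σ hσ.1).1
  obtain ⟨M, hM⟩ := isCompact_Icc.exists_bound_of_continuousOn hG
  have hw : ∀ σ, 0 ≤ σ → 0 ≤ 1 - gauge α β a (x σ) := fun σ hσ => by
    have h1 := (hx σ hσ).1
    rw [h.closedDisc_eq] at h1
    exact sub_nonneg.2 h1.2
  -- An integrating factor for `w' = -2Gw`: since `G ≤ M` on `[0, τ]`, the product `e^{2Mσ} w` is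
  -- nondecreasing there, so `w` stays positive.
  have hderiv : ∀ σ, 0 ≤ σ → HasDerivWithinAt
      (fun σ => Real.exp (2 * M * σ) * (1 - gauge α β a (x σ)))
      (2 * (M - radialRate α β c a k f fα (x σ)) *
        (Real.exp (2 * M * σ) * (1 - gauge α β a (x σ)))) (Ici 0) σ := fun σ hσ => by
    have h1 : HasDerivAt (fun σ : ℝ => Real.exp (2 * M * σ))
        (Real.exp (2 * M * σ) * (2 * M)) σ := by
      have := ((hasDerivAt_id σ).const_mul (2 * M)).exp
      simpa using this
    refine (h1.hasDerivWithinAt.mul (h.hasDerivWithinAt_one_sub_gauge (hx σ hσ).2)).congr_deriv ?_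
    ring
  have hmono : MonotoneOn (fun σ => Real.exp (2 * M * σ) * (1 - gauge α β a (x σ))) (Icc 0 τ) := by
    refine monotoneOn_of_hasDerivWithinAt_nonneg (convex_Icc 0 τ)
      (fun σ hσ => (hderiv σ hσ.1).continuousWithinAt.mono Icc_subset_Ici_self)
      (fun σ hσ => (hderiv σ (interior_subset hσ).1).mono
        (interior_subset.trans Icc_subset_Ici_self)) fun σ hσ => ?_
    have hσ' := interior_subset hσ
    have h1 := (le_abs_self _).trans (hM σ hσ')
    have h2 := hw σ hσ'.1
    have h3 : 0 ≤ M - radialRate α β c a k f fα (x σ) := by linarith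
    positivity
  have h1 := hmono (left_mem_Icc.2 hτ) (right_mem_Icc.2 hτ) hτ
  rw [h.disc_eq] at hx0 ⊢
  have h2 : 0 < 1 - gauge α β a (x 0) := sub_pos.2 hx0.2
  have h3 : 0 < Real.exp (2 * M * τ) * (1 - gauge α β a (x τ)) := by
    refine lt_of_lt_of_le ?_ h1
    simpa using h2
  have h4 : 0 < 1 - gauge α β a (x τ) := pos_of_mul_pos_right h3 (Real.exp_pos _).le
  have h5 := (hx τ hτ).1
  rw [h.closedDisc_eq] at h5
  exact ⟨h5.1, sub_pos.1 h4⟩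

/-- If an orbit off the horizon converges to a point of the horizon, then the radial rate is
nonnegative there. -/
theorem radialRate_nonneg_of_tendsto (h : IsCompactificationData α β c a) (hW : IsOpen W)
    (hf : IsAsymptoticallyQuasiHomogeneous α k W f fα) {x : ℝ → Fin n → ℝ} {xs : Fin n → ℝ}
    (hxs : xs ∈ horizon α β c a W) (hx0 : x 0 ∈ disc α β c a W)
    (hx : ∀ τ, 0 ≤ τ → x τ ∈ closedDisc α β c a W ∧
      HasDerivWithinAt x (desingularized α β c a k f fα (x τ)) (Ici 0) τ)
    (hlim : Tendsto x atTop (𝓝 xs)) : 0 ≤ radialRate α β c a k f fα xs := by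
  by_contra! hneg
  have hG : Tendsto (fun τ => radialRate α β c a k f fα (x τ)) atTop
      (𝓝 (radialRate α β c a k f fα xs)) :=
    (h.continuousOn_radialRate hW hf xs (Or.inr hxs)).tendsto.comp
      (tendsto_nhdsWithin_iff.2 ⟨hlim, (eventually_ge_atTop 0).mono fun τ hτ => (hx τ hτ).1⟩)
  obtain ⟨τ₀, hτ₀⟩ := eventually_atTop.1
    ((hG.eventually (gt_mem_nhds hneg)).and (eventually_ge_atTop 0))
  have hτ₀0 : 0 ≤ τ₀ := (hτ₀ τ₀ le_rfl).2
  have hpos : ∀ τ, 0 ≤ τ → 0 < 1 - gauge α β a (x τ) := fun τ hτ => by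
    have := h.mem_disc_of_solution hW hf hx0 hx hτ
    rw [h.disc_eq] at this
    exact sub_pos.2 this.2
  -- Once `G < 0` along the orbit, the positive quantity `1 - q` no longer decreases, yet it must
  -- tend to `0`.
  have hmono : MonotoneOn (fun σ => 1 - gauge α β a (x σ)) (Ici τ₀) := by
    have hd : ∀ σ ∈ Ici τ₀, HasDerivWithinAt (fun σ => 1 - gauge α β a (x σ))
        (-(2 * radialRate α β c a k f fα (x σ)) * (1 - gauge α β a (x σ))) (Ici τ₀) σ :=
      fun σ hσ => (h.hasDerivWithinAt_one_sub_gauge (hx σ (hτ₀0.trans hσ)).2).mono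
        (Ici_subset_Ici.2 hτ₀0)
    refine monotoneOn_of_hasDerivWithinAt_nonneg (convex_Ici τ₀)
      (fun σ hσ => (hd σ hσ).continuousWithinAt)
      (fun σ hσ => (hd σ (interior_subset hσ)).mono interior_subset) fun σ hσ => ?_
    have hσ' : τ₀ ≤ σ := interior_subset hσ
    exact mul_nonneg (by linarith [(hτ₀ σ hσ').1]) (hpos σ (hτ₀0.trans hσ')).le
  have hw : Tendsto (fun σ => 1 - gauge α β a (x σ)) atTop (𝓝 0) := by
    have h1 := (((continuous_gauge (α := α) (β := β) (a := a)).tendsto xs).comp hlim).const_sub 1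
    rw [(h.p_eq_one_iff xs).1 hxs.2, sub_self] at h1
    exact h1
  have h1 := ge_of_tendsto hw ((eventually_ge_atTop τ₀).mono fun σ hσ =>
    hmono (mem_Ici.2 le_rfl) hσ hσ)
  exact absurd (hpos τ₀ hτ₀0) (not_lt.2 h1)

end IsCompactificationData

end StableSet

/-! ### The time change `dτ = κ^k dt` -/

section TimeChange

variable {n : ℕ} {α β : Fin n → ℕ} {c : ℕ} {a : Fin n → ℝ} {k : ℕ}
  {W : Set ({i : Fin n // α i = 0} → ℝ)} {f fα : (Fin n → ℝ) → (Fin n → ℝ)}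
  {y : ℝ → Fin n → ℝ} {t₀ : ℝ} {T : EReal}

/-- The desingularized time `τ`, with `dτ = κ(y(t))^k dt`. -/
noncomputable def rescaledTime (α β : Fin n → ℕ) (c : ℕ) (a : Fin n → ℝ) (k : ℕ)
    (y : ℝ → Fin n → ℝ) (t₀ t : ℝ) : ℝ :=
  ∫ r in t₀..t, kappa α β c a (y r) ^ k

namespace IsCompactificationData

theorem continuous_kappa (h : IsCompactificationData α β c a) :
    Continuous (kappa α β c a) := by
  have : kappa α β c a = fun y => (1 + gauge α β a y) ^ (1 / (2 * c : ℝ)) :=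
    funext h.kappa_eq
  rw [this]
  exact (continuous_const.add continuous_gauge).rpow_const fun y =>
    Or.inl (show 1 + gauge α β a y ≠ 0 by linarith [h.gauge_nonneg y])

theorem continuousOn_kappa_pow (h : IsCompactificationData α β c a)
    (hy : IsSolutionOn f (admissibleDomain α W) y t₀ T) {t : ℝ} (ht : (t : EReal) < T) :
    ContinuousOn (fun r => kappa α β c a (y r) ^ k) (Icc t₀ t) := by
  have hyc : ContinuousOn y (Icc t₀ t) := fun r hr =>
    (hy r hr.1 ((EReal.coe_le_coe_iff.2 hr.2).trans_lt ht)).2.continuousWithinAt.mono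
      Icc_subset_Ici_self
  exact (h.continuous_kappa.comp_continuousOn hyc).pow k

theorem intervalIntegrable_kappa_pow (h : IsCompactificationData α β c a)
    (hy : IsSolutionOn f (admissibleDomain α W) y t₀ T) {t : ℝ} (ht₀ : t₀ ≤ t)
    (ht : (t : EReal) < T) :
    IntervalIntegrable (fun r => kappa α β c a (y r) ^ k) MeasureTheory.volume t₀ t :=
  ContinuousOn.intervalIntegrable (by
    rw [uIcc_of_le ht₀]
    exact h.continuousOn_kappa_pow hy ht)

theorem rescaledTime_nonneg (h : IsCompactificationData α β c a) {t : ℝ} (ht : t₀ ≤ t) :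
    0 ≤ rescaledTime α β c a k y t₀ t :=
  intervalIntegral.integral_nonneg ht fun r _ => pow_nonneg (h.kappa_pos (y r)).le _

/-- Since `κ ≥ 1`, infinite existence time forces `τ → ∞`. -/
theorem sub_le_rescaledTime (h : IsCompactificationData α β c a)
    (hy : IsSolutionOn f (admissibleDomain α W) y t₀ T) {t : ℝ} (ht₀ : t₀ ≤ t)
    (ht : (t : EReal) < T) : t - t₀ ≤ rescaledTime α β c a k y t₀ t := by
  have h1 : ∫ _ in t₀..t, (1 : ℝ) = t - t₀ := by simp
  rw [← h1]
  exact intervalIntegral.integral_mono_on ht₀ (by simp)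
    (h.intervalIntegrable_kappa_pow hy ht₀ ht) fun r _ => one_le_pow₀ (h.one_le_kappa _)

theorem rescaledTime_mono (h : IsCompactificationData α β c a)
    (hy : IsSolutionOn f (admissibleDomain α W) y t₀ T) {r t : ℝ} (hr : t₀ ≤ r) (hrt : r ≤ t)
    (ht : (t : EReal) < T) :
    rescaledTime α β c a k y t₀ r ≤ rescaledTime α β c a k y t₀ t :=
  intervalIntegral.integral_mono_interval le_rfl hr hrt
    (Eventually.of_forall fun r => pow_nonneg (h.kappa_pos (y r)).le _)
    (h.intervalIntegrable_kappa_pow hy (hr.trans hrt) ht)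

theorem hasDerivWithinAt_rescaledTime (h : IsCompactificationData α β c a)
    (hy : IsSolutionOn f (admissibleDomain α W) y t₀ T) {r t : ℝ} (hr : r ∈ Ico t₀ t)
    (ht : (t : EReal) < T) :
    HasDerivWithinAt (rescaledTime α β c a k y t₀) (kappa α β c a (y r) ^ k) (Ici r) r := by
  have hrT : (r : EReal) < T := (EReal.coe_lt_coe_iff.2 hr.2).trans ht
  have hcont := h.continuousOn_kappa_pow (k := k) hy ht
  have hle : 𝓝[>] r ≤ 𝓝[Icc t₀ t] r :=
    nhdsWithin_le_iff.2 (mem_of_superset (Ioc_mem_nhdsGT hr.2)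
      fun z hz => ⟨hr.1.trans hz.1.le, hz.2⟩)
  exact intervalIntegral.integral_hasDerivWithinAt_right
    (h.intervalIntegrable_kappa_pow hy hr.1 hrT)
    ((hcont.stronglyMeasurableAtFilter_nhdsWithin measurableSet_Icc r).filter_mono hle)
    ((hcont r ⟨hr.1, hr.2.le⟩).tendsto.mono_left hle)

/-- In the rescaled time, the compactification of a solution follows the orbit of the desingularized
system with the same initial point. -/
theorem compactification_eq_orbit (h : IsCompactificationData α β c a) (hW : IsOpen W)
    (hf : IsAsymptoticallyQuasiHomogeneous α k W f fα)
    (hy : IsSolutionOn f (admissibleDomain α W) y t₀ T) {x : ℝ → Fin n → ℝ}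
    (hx0 : x 0 = compactification α β c a (y t₀))
    (hx : ∀ τ, 0 ≤ τ → x τ ∈ disc α β c a W ∧
      HasDerivWithinAt x (desingularized α β c a k f fα (x τ)) (Ici 0) τ)
    {t : ℝ} (ht₀ : t₀ ≤ t) (ht : (t : EReal) < T) :
    compactification α β c a (y t) = x (rescaledTime α β c a k y t₀ t) := by
  have hlt : ∀ r ∈ Icc t₀ t, (r : EReal) < T := fun r hr =>
    (EReal.coe_le_coe_iff.2 hr.2).trans_lt ht
  have hu : ∀ r ∈ Icc t₀ t, HasDerivWithinAt (fun r => compactification α β c a (y r))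
      (kappa α β c a (y r) ^ k •
        desingularized α β c a k f fα (compactification α β c a (y r))) (Ici t₀) r :=
    fun r hr => h.hasDerivWithinAt_compactification (hy r hr.1 (hlt r hr)).2
  have hτc : ContinuousOn (rescaledTime α β c a k y t₀) (Icc t₀ t) := by
    rw [← uIcc_of_le ht₀]
    exact intervalIntegral.continuousOn_primitive_interval'
      (h.intervalIntegrable_kappa_pow hy ht₀ ht) left_mem_uIcc
  have hxc : ContinuousOn x (Ici 0) := fun τ hτ => (hx τ hτ).2.continuousWithinAt
  -- Both curves solve the same nonautonomous equation `u' = κ(y(t))^k g(u)`, whose coefficient is a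
  -- fixed function of `t`.
  refine eqOn_of_hasDerivWithinAt_smul (h.isOpen_disc hW) (h.contDiffOn_desingularized hf)
    (h.continuousOn_kappa_pow (k := k) hy ht)
    (u := fun r => compactification α β c a (y r))
    (v := fun r => x (rescaledTime α β c a k y t₀ r))
    (fun r hr => (hu r hr).continuousWithinAt.mono Icc_subset_Ici_self)
    (hxc.comp hτc fun r hr => h.rescaledTime_nonneg hr.1)
    (fun r hr => h.compactification_mem_disc (hy r hr.1 (hlt r hr)).1)
    (fun r hr => (hx _ (h.rescaledTime_nonneg hr.1)).1)
    (fun r hr => (hu r (Ico_subset_Icc_self hr)).mono (Ici_subset_Ici.2 hr.1))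
    (fun r hr => ?_) ?_ (right_mem_Icc.2 ht₀)
  · exact (hx _ (h.rescaledTime_nonneg hr.1)).2.scomp r
      (h.hasDerivWithinAt_rescaledTime hy hr ht)
      fun z hz => h.rescaledTime_nonneg (hr.1.trans hz)
  · simp [rescaledTime, hx0]

/-- The desingularized time runs to infinity at a finite maximal existence time. -/
theorem tendsto_rescaledTime (h : IsCompactificationData α β c a) (hW : IsOpen W)
    (hf : IsAsymptoticallyQuasiHomogeneous α k W f fα) {T : ℝ}
    (hy : IsMaximalSolution f (admissibleDomain α W) y t₀ T) {x : ℝ → Fin n → ℝ}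
    (hx0 : x 0 = compactification α β c a (y t₀))
    (hx : ∀ τ, 0 ≤ τ → x τ ∈ disc α β c a W ∧
      HasDerivWithinAt x (desingularized α β c a k f fα (x τ)) (Ici 0) τ) :
    Tendsto (rescaledTime α β c a k y t₀) (𝓝[<] T) atTop := by
  have ht₀T : t₀ < T := EReal.coe_lt_coe_iff.1 hy.lt
  have hmono : ∀ {r t : ℝ}, t₀ ≤ r → r ≤ t → t < T →
      rescaledTime α β c a k y t₀ r ≤ rescaledTime α β c a k y t₀ t := fun h1 h2 h3 =>
    h.rescaledTime_mono hy.solution h1 h2 (EReal.coe_lt_coe_iff.2 h3)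
  -- If `τ` were bounded it would converge to some `S`, the compactified solution to `x(S)` in the
  -- open set `𝒟`, and hence `y` to a point of `U`, against maximality.
  by_cases hbdd : BddAbove (rescaledTime α β c a k y t₀ '' Ioo t₀ T)
  · exfalso
    have hne : (Ioo t₀ T).Nonempty := nonempty_Ioo.2 ht₀T
    have hlim := MonotoneOn.tendsto_nhdsWithin_Ioo_left hne
      (fun r hr t ht hrt => hmono hr.1.le hrt ht.2) hbdd
    set S := sSup (rescaledTime α β c a k y t₀ '' Ioo t₀ T)
    have hev : ∀ᶠ t in 𝓝[<] T, t ∈ Ioo t₀ T := Ioo_mem_nhdsLT ht₀T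
    have hS : 0 ≤ S := ge_of_tendsto hlim (hev.mono fun t ht => h.rescaledTime_nonneg ht.1.le)
    have hX : Tendsto (fun t => compactification α β c a (y t)) (𝓝[<] T) (𝓝 (x S)) := by
      have h1 : Tendsto (rescaledTime α β c a k y t₀) (𝓝[<] T) (𝓝[Ici 0] S) :=
        tendsto_nhdsWithin_iff.2 ⟨hlim, hev.mono fun t ht => h.rescaledTime_nonneg ht.1.le⟩
      refine ((hx S hS).2.continuousWithinAt.tendsto.comp h1).congr' (hev.mono fun t ht => ?_)
      exact (h.compactification_eq_orbit hW hf hy.solution hx0 hx ht.1.le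
        (EReal.coe_lt_coe_iff.2 ht.2)).symm
    have hxS := (hx S hS).1
    rw [h.disc_eq] at hxS
    have hcont : ContinuousAt (fun z => scale α (kappaX α β c a z) z) (x S) := by
      have hκ : ContinuousAt (kappaX α β c a) (x S) :=
        (continuous_const.sub continuous_gauge).continuousAt.rpow_const
          (Or.inl (sub_pos.2 hxS.2).ne')
      exact continuousAt_pi.2 fun i => (hκ.pow _).mul (continuous_apply i).continuousAt
    refine hy.not_tendsto (isOpen_admissibleDomain hW) (hf.smooth.of_le (by simp))
      ((scale_mem_admissibleDomain _).2 hxS.1) ((hcont.tendsto.comp hX).congr fun t => ?_)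
    simp only [Function.comp_apply, h.kappaX_compactification, h.scale_kappa]
  · refine tendsto_atTop.2 fun B => ?_
    obtain ⟨_, ⟨r, hr, rfl⟩, hB⟩ := not_bddAbove_iff.1 hbdd B
    filter_upwards [Ioo_mem_nhdsLT hr.2] with t ht
    exact hB.le.trans (hmono hr.1.le ht.1.le ht.2)

end IsCompactificationData

end TimeChange

/-! ### Finite-time blow-up and the rate of `κ` -/

section BlowUp

variable {n : ℕ} {α β : Fin n → ℕ} {c : ℕ} {a : Fin n → ℝ} {k : ℕ}
  {W : Set ({i : Fin n // α i = 0} → ℝ)} {f fα : (Fin n → ℝ) → (Fin n → ℝ)}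
  {y : ℝ → Fin n → ℝ} {t₀ : ℝ} {xs : Fin n → ℝ}

theorem isEquivalent_of_tendsto_mul_rpow {φ : ℝ → ℝ} {T C e : ℝ} (hC : C ≠ 0)
    (hφ : Tendsto (fun t => φ t * (T - t) ^ e) (𝓝[<] T) (𝓝 C)) :
    φ ~[𝓝[<] T] fun t => C * (T - t) ^ (-e) := by
  refine isEquivalent_of_tendsto_one ?_
  have h1 := hφ.div_const C
  rw [div_self hC] at h1
  refine h1.congr' ?_
  filter_upwards [self_mem_nhdsWithin] with t ht
  have ht' : 0 < T - t := sub_pos.2 ht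
  rw [Pi.div_apply, Real.rpow_neg ht'.le]
  have := (Real.rpow_pos_of_pos ht' e).ne'
  field_simp

/-- A positive function on a half-line cannot have a derivative with negative limit. -/
theorem not_tendsto_deriv_neg {u u' : ℝ → ℝ} {t₀ A : ℝ} (hA : 0 < A)
    (hu : ∀ t, t₀ ≤ t → HasDerivWithinAt u (u' t) (Ici t₀) t) (hpos : ∀ t, 0 < u t) :
    ¬ Tendsto u' atTop (𝓝 (-A)) := by
  intro hlim
  obtain ⟨t₁, ht₁⟩ := eventually_atTop.1
    ((hlim.eventually (gt_mem_nhds (show -A < -(A / 2) by linarith))).and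
      (eventually_ge_atTop t₀))
  have ht₀₁ : t₀ ≤ t₁ := (ht₁ t₁ le_rfl).2
  -- From `t₁` on the slope is below `-A/2`, so `u` lies below a line that reaches zero at `t₁ +
  -- u(t₁)/(A/2)`.
  have hd : ∀ t ∈ Ici t₁, HasDerivWithinAt (fun t => u t + A / 2 * t) (u' t + A / 2) (Ici t₁) t :=
    fun t ht => ((hu t (ht₀₁.trans ht)).mono (Ici_subset_Ici.2 ht₀₁)).add (by
      simpa using ((hasDerivAt_id t).const_mul (A / 2)).hasDerivWithinAt)
  have hanti : AntitoneOn (fun t => u t + A / 2 * t) (Ici t₁) :=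
    antitoneOn_of_hasDerivWithinAt_nonpos (convex_Ici t₁)
      (fun t ht => (hd t ht).continuousWithinAt)
      (fun t ht => (hd t (interior_subset ht)).mono interior_subset)
      fun t ht => by linarith [(ht₁ t (interior_subset ht)).1]
  have hle : t₁ ≤ t₁ + u t₁ / (A / 2) := by
    have := hpos t₁
    have : 0 ≤ u t₁ / (A / 2) := by positivity
    linarith
  have h1 := hanti (mem_Ici.2 le_rfl) (mem_Ici.2 hle) hle
  have h2 : A / 2 * (t₁ + u t₁ / (A / 2)) = A / 2 * t₁ + u t₁ := by field_simp
  simp only [h2] at h1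
  linarith [hpos (t₁ + u t₁ / (A / 2))]

namespace IsCompactificationData

theorem tendsto_compactification_nhdsWithin (h : IsCompactificationData α β c a) {l : Filter ℝ}
    (hyU : ∀ᶠ t in l, y t ∈ admissibleDomain α W)
    (hX : Tendsto (fun t => compactification α β c a (y t)) l (𝓝 xs)) :
    Tendsto (fun t => compactification α β c a (y t)) l (𝓝[disc α β c a W] xs) :=
  tendsto_nhdsWithin_iff.2 ⟨hX, hyU.mono fun _ ht => h.compactification_mem_disc ht⟩

theorem tendsto_radialRate (h : IsCompactificationData α β c a) (hW : IsOpen W)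
    (hf : IsAsymptoticallyQuasiHomogeneous α k W f fα) (hxs : xs ∈ horizon α β c a W)
    {l : Filter ℝ} (hyU : ∀ᶠ t in l, y t ∈ admissibleDomain α W)
    (hX : Tendsto (fun t => compactification α β c a (y t)) l (𝓝 xs)) :
    Tendsto (fun t => radialRate α β c a k f fα (compactification α β c a (y t))) l
      (𝓝 (radialRate α β c a k f fα xs)) :=
  ((h.continuousOn_radialRate hW hf xs (Or.inr hxs)).tendsto.mono_left
    (nhdsWithin_mono _ subset_union_left)).comp (h.tendsto_compactification_nhdsWithin hyU hX)

theorem tendsto_kappa (h : IsCompactificationData α β c a) (hxs : xs ∈ horizon α β c a W)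
    {l : Filter ℝ} (hX : Tendsto (fun t => compactification α β c a (y t)) l (𝓝 xs)) :
    Tendsto (fun t => kappa α β c a (y t)) l atTop := by
  refine ((h.tendsto_kappaX ((h.p_eq_one_iff xs).1 hxs.2)).comp (tendsto_nhdsWithin_iff.2
    ⟨hX, Eventually.of_forall fun t => h.gauge_compactification_lt_one (y t)⟩)).congr fun t => ?_
  exact h.kappaX_compactification (y t)

/-- The growth of `κ` along a solution whose compactification converges to a point of the horizon
with positive radial rate. -/
theorem tendsto_kappa_mul_rpow (h : IsCompactificationData α β c a) (hk : 1 ≤ k) (hW : IsOpen W)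
    (hf : IsAsymptoticallyQuasiHomogeneous α k W f fα) (hxs : xs ∈ horizon α β c a W)
    (hpos : 0 < radialRate α β c a k f fα xs) {T : ℝ} (ht₀T : t₀ < T)
    (hy : IsSolutionOn f (admissibleDomain α W) y t₀ T)
    (hX : Tendsto (fun t => compactification α β c a (y t)) (𝓝[<] T) (𝓝 xs)) :
    Tendsto (fun t => kappa α β c a (y t) * (T - t) ^ (1 / (k : ℝ))) (𝓝[<] T)
      (𝓝 ((k / c * radialRate α β c a k f fα xs) ^ (-(1 / (k : ℝ))))) := by
  have hk0 : k ≠ 0 := by omega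
  have hc0 := h.c_pos
  have hev : ∀ᶠ t in 𝓝[<] T, t ∈ Ioo t₀ T := Ioo_mem_nhdsLT ht₀T
  have hsol : ∀ t ∈ Ioo t₀ T, y t ∈ admissibleDomain α W ∧ HasDerivAt y (f (y t)) t :=
    fun t ht => by
      have h1 := hy t ht.1.le (EReal.coe_lt_coe_iff.2 ht.2)
      exact ⟨h1.1, h1.2.hasDerivAt (Ici_mem_nhds ht.1)⟩
  have hA : 0 < k / c * radialRate α β c a k f fα xs := by positivity
  -- L'Hôpital's rule in the form `0/0`: the derivatives are `-(k/c)G` and `-1`.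
  have hratio : Tendsto (fun t => (kappa α β c a (y t) ^ k)⁻¹ / (T - t)) (𝓝[<] T)
      (𝓝 (k / c * radialRate α β c a k f fα xs)) := by
    refine HasDerivAt.lhopital_zero_nhdsLT (g := fun t => T - t) (g' := fun _ => -1)
      (f' := fun t => -(k / c * radialRate α β c a k f fα (compactification α β c a (y t))))
      (hev.mono fun t ht => ?_) (Eventually.of_forall fun t => (hasDerivAt_id t).const_sub T)
      (Eventually.of_forall fun _ => by norm_num) ?_ ?_ ?_
    · have := h.hasDerivWithinAt_inv_kappa_pow (fα := fα) hk
        (hsol t ht).2.hasDerivWithinAt (s := univ)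
      rwa [hasDerivWithinAt_univ] at this
    · exact tendsto_inv_atTop_zero.comp
        ((tendsto_pow_atTop hk0).comp (h.tendsto_kappa hxs hX))
    · have : Tendsto (fun t => T - t) (𝓝 T) (𝓝 (T - T)) :=
        (continuous_const.sub continuous_id).tendsto T
      rw [sub_self] at this
      exact this.mono_left nhdsWithin_le_nhds
    · simp only [neg_div_neg_eq, div_one]
      exact (h.tendsto_radialRate hW hf hxs (hev.mono fun t ht => (hsol t ht).1) hX).const_mul _
  refine (hratio.rpow_const (p := -(1 / (k : ℝ))) (Or.inl hA.ne')).congr' ?_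
  filter_upwards [hev] with t ht
  have ht' : 0 < T - t := sub_pos.2 ht.2
  have hκ := h.kappa_pos (y t)
  have h1 : (kappa α β c a (y t) ^ k) ^ (1 / (k : ℝ)) = kappa α β c a (y t) := by
    rw [one_div]
    exact Real.pow_rpow_inv_natCast hκ.le hk0
  rw [Real.rpow_neg (by positivity), Real.div_rpow (by positivity) ht'.le,
    Real.inv_rpow (by positivity), h1]
  rw [inv_div, div_inv_eq_mul, mul_comm]

end IsCompactificationData

end BlowUp

end QuasiPoincare

/-! ### The blow-up theorem -/

open QuasiPoincare

theorem mainTheorem1 {n : ℕ} (α β : Fin n → ℕ) (c : ℕ) (a : Fin n → ℝ)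
    (hdata : QuasiPoincare.IsCompactificationData α β c a)
    (k : ℕ) (hk : 1 ≤ k)
    (W : Set ({i : Fin n // α i = 0} → ℝ)) (hW : IsOpen W)
    (f fα : (Fin n → ℝ) → (Fin n → ℝ))
    (hf : QuasiPoincare.IsAsymptoticallyQuasiHomogeneous α k W f fα)
    (xs : Fin n → ℝ)
    (hxs : QuasiPoincare.IsEquilibriumAtInfinity α β c a W k f fα xs)
    (V : Set (Fin n → ℝ))
    (hVopen : ∃ O : Set (Fin n → ℝ), IsOpen O ∧
      V = O ∩ QuasiPoincare.closedDisc α β c a W)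
    (hVhorizon : QuasiPoincare.horizon α β c a W ⊆ V)
    (hg : ContDiffOn ℝ 1 (QuasiPoincare.desingularized α β c a k f fα) V)
    (hhyp : QuasiPoincare.IsHyperbolicMatrix
      (QuasiPoincare.jacobianWithin (QuasiPoincare.desingularized α β c a k f fα) V xs))
    (hns : 0 < QuasiPoincare.stableCount
      (QuasiPoincare.jacobianWithin (QuasiPoincare.desingularized α β c a k f fα) V xs))
    (y : ℝ → (Fin n → ℝ)) (t₀ : ℝ) (tmax : EReal)
    (hy : QuasiPoincare.IsMaximalSolution f (QuasiPoincare.admissibleDomain α W) y t₀ tmax)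
    (hys : QuasiPoincare.compactification α β c a (y t₀) ∈
      QuasiPoincare.stableSet (QuasiPoincare.desingularized α β c a k f fα)
        (QuasiPoincare.closedDisc α β c a W) xs) :
    ∃ T : ℝ, tmax = (T : EReal) ∧
      (∃ C : ℝ, 0 < C ∧
        (fun t => QuasiPoincare.p α β c a (y t)) ~[𝓝[<] T]
          (fun t => C * (T - t) ^ (-(1 / (k : ℝ))))) ∧
      (∀ i ∈ QuasiPoincare.homIndices α, xs i ≠ 0 →
        ∃ C : ℝ, C ≠ 0 ∧
          (fun t => y t i) ~[𝓝[<] T]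
            (fun t => C * (T - t) ^ (-((α i : ℝ) / (k : ℝ))))) := by
  obtain ⟨O, hO, rfl⟩ := hVopen
  obtain ⟨x, hx0, hx, hxlim⟩ := hys
  have hxsV := hVhorizon hxs.1
  have hx0d : x 0 ∈ disc α β c a W := by
    rw [hx0]
    exact hdata.compactification_mem_disc (hy.solution t₀ le_rfl hy.lt).1
  have hpos : 0 < radialRate α β c a k f fα xs :=
    lt_of_le_of_ne (hdata.radialRate_nonneg_of_tendsto hW hf hxs.1 hx0d hx hxlim)
      (hdata.radialRate_ne_zero hW hf hxs hO hxsV.1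
        ((hg xs hxsV).differentiableWithinAt one_ne_zero) hhyp).symm
  have hxd : ∀ τ, 0 ≤ τ → x τ ∈ disc α β c a W ∧
      HasDerivWithinAt x (desingularized α β c a k f fα (x τ)) (Ici 0) τ := fun τ hτ =>
    ⟨hdata.mem_disc_of_solution hW hf hx0d hx hτ, (hx τ hτ).2⟩
  have hc0 := hdata.c_pos
  have hA : 0 < k / c * radialRate α β c a k f fα xs := by positivity
  induction tmax using EReal.rec with
  | bot => exact absurd hy.lt not_lt_bot
  | top =>
    -- With `t_max = ∞`, `x(t) → x_*` and the positive function `κ^{-k}` would have slope tending to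
    -- `-(k/c)G(x_*) < 0`.
    exfalso
    have hsol := fun t ht => hy.solution t ht (EReal.coe_lt_top t)
    have hτ : Tendsto (rescaledTime α β c a k y t₀) atTop atTop := by
      refine tendsto_atTop_mono' _ ?_ (tendsto_atTop_add_const_right _ (-t₀) tendsto_id)
      filter_upwards [eventually_ge_atTop t₀] with t ht
      exact hdata.sub_le_rescaledTime hy.solution ht (EReal.coe_lt_top t)
    have hX : Tendsto (fun t => compactification α β c a (y t)) atTop (𝓝 xs) := by
      refine (hxlim.comp hτ).congr' ?_
      filter_upwards [eventually_ge_atTop t₀] with t ht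
      exact (hdata.compactification_eq_orbit hW hf hy.solution hx0 hxd ht
        (EReal.coe_lt_top t)).symm
    refine not_tendsto_deriv_neg hA
      (fun t ht => hdata.hasDerivWithinAt_inv_kappa_pow (fα := fα) hk (hsol t ht).2)
      (fun t => inv_pos.2 (pow_pos (hdata.kappa_pos (y t)) k)) ?_
    exact ((hdata.tendsto_radialRate hW hf hxs.1
      ((eventually_ge_atTop t₀).mono fun t ht => (hsol t ht).1) hX).const_mul _).neg
  | coe T =>
    have ht₀T : t₀ < T := EReal.coe_lt_coe_iff.1 hy.lt
    have hX : Tendsto (fun t => compactification α β c a (y t)) (𝓝[<] T) (𝓝 xs) := by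
      refine (hxlim.comp (hdata.tendsto_rescaledTime hW hf hy hx0 hxd)).congr' ?_
      filter_upwards [Ioo_mem_nhdsLT ht₀T] with t ht
      exact (hdata.compactification_eq_orbit hW hf hy.solution hx0 hxd ht.1.le
        (EReal.coe_lt_coe_iff.2 ht.2)).symm
    have hκ := hdata.tendsto_kappa_mul_rpow hk hW hf hxs.1 hpos ht₀T hy.solution hX
    -- `C` is the limit of `κ (T - t)^{1/k}`. It serves `p(y) = κ p(x)` unchanged, as `p(x) → 1`,
    -- and `y_i = κ^{α_i} x_i` turns it into `C^{α_i} (x_*)_i`.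
    set C := (k / c * radialRate α β c a k f fα xs) ^ (-(1 / (k : ℝ)))
    have hC : 0 < C := Real.rpow_pos_of_pos hA _
    refine ⟨T, rfl, ⟨C, hC, isEquivalent_of_tendsto_mul_rpow hC.ne' ?_⟩, fun i hi hxi =>
      ⟨C ^ α i * xs i, by positivity, isEquivalent_of_tendsto_mul_rpow (by positivity) ?_⟩⟩
    · have hp : Tendsto (fun t => p α β c a (compactification α β c a (y t))) (𝓝[<] T) (𝓝 1) := by
        have h1 : ContinuousAt (p α β c a) xs :=
          continuous_gauge.continuousAt.rpow_const
            (Or.inl (by rw [(hdata.p_eq_one_iff xs).1 hxs.1.2]; exact one_ne_zero))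
        have h2 := h1.tendsto.comp hX
        rwa [hxs.1.2] at h2
      have h3 := hκ.mul hp
      rw [mul_one] at h3
      refine h3.congr fun t => ?_
      have h4 := hdata.p_scale (hdata.kappa_pos (y t)).le (compactification α β c a (y t))
      rw [hdata.scale_kappa] at h4
      rw [h4]
      ring
    · have hXi : Tendsto (fun t => compactification α β c a (y t) i) (𝓝[<] T) (𝓝 (xs i)) :=
        ((continuous_apply i).tendsto xs).comp hX
      refine ((hκ.pow (α i)).mul hXi).congr' ?_
      filter_upwards [Ioo_mem_nhdsLT ht₀T] with t ht
      have ht' : 0 < T - t := sub_pos.2 ht.2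
      have h1 : y t i = kappa α β c a (y t) ^ α i * compactification α β c a (y t) i :=
        (congrFun (hdata.scale_kappa (y t)) i).symm
      have h2 : (T - t) ^ ((α i : ℝ) / k) = ((T - t) ^ (1 / (k : ℝ))) ^ α i := by
        rw [← Real.rpow_mul_natCast ht'.le]
        congr 1
        ring
      rw [h1, h2]
      ring
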